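/- For $n\ge 2$, let $P_n$ be the convex polygon inscribed in the unit circle of $\mathbb C$ whose vertices are the $n$-th roots of unity. A non-crossing tree of $P_n$ is a tree whose vertices are the vertices of $P_n$ and whose edges, drawn as straight line segments, do not cross (distinct edges meet at most at common endpoints). Let $\mathcal T_n$ be uniformly distributed over the set of all non-crossing trees of $P_n$, viewed as a tree rooted at the vertex $1$, and let $\Delta(\mathcal T_n)$ be its maximum outdegree, that is, the maximal number of children of a vertex. Then for every $c>0$ there exist constants $C_1,C_2>0$ such that for every $n\ge 2$, $$\mathbb P\bigl(\Delta(\mathcal T_n)\ge \log_3 n+(1+c)\log_3\log_3 n\bigr)\le \frac{C_1}{(\log_3 n)^{c}}$$ and $$\mathbb P\bigl(\Delta(\mathcal T_n)\le \log_3 n+(1-c)\log_3\log_3 n\bigr)\le C_1e^{-C_2(\log_3 n)^{c}}.$$ -/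

import Mathlib

open ProbabilityTheory

namespace NonCrossing

/-- The `k`-th vertex `exp (2 π i k / n)` of the regular `n`-gon inscribed in the unit circle. -/
noncomputable def polygonVertex (n : ℕ) (k : Fin n) : ℂ :=
  Complex.exp (2 * Real.pi * Complex.I * ((k : ℕ) : ℂ) / (n : ℂ))

/-- A graph on the vertices of the regular `n`-gon, drawn with straight edges, is a non-crossing
tree if it is a tree and the (relatively open) line segments that represent two different edges
never meet. -/
def IsNonCrossingTree {n : ℕ} (G : SimpleGraph (Fin n)) : Prop :=
  G.IsTree ∧ ∀ a b x y : Fin n, G.Adj a b → G.Adj x y → s(a, b) ≠ s(x, y) →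
    Disjoint (openSegment ℝ (polygonVertex n a) (polygonVertex n b))
      (openSegment ℝ (polygonVertex n x) (polygonVertex n y))

/-- The set of all non-crossing trees of the `n`-gon. -/
def nonCrossingTrees (n : ℕ) : Set (SimpleGraph (Fin n)) :=
  {G | IsNonCrossingTree G}

/-- The outdegree of `v` in the tree `G` rooted at `r`: the number of children of `v`, that is, of
neighbours of `v` which are one step further away from the root than `v`. -/
noncomputable def outdegree {V : Type*} (G : SimpleGraph V) (r v : V) : ℕ :=
  Set.ncard {w : V | G.Adj v w ∧ G.dist r w = G.dist r v + 1}

/-- The maximum outdegree of the tree `G` rooted at `r`. -/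
noncomputable def maxOutdegree {V : Type*} [Fintype V] (G : SimpleGraph V) (r : V) : ℕ :=
  Finset.univ.sup (outdegree G r)

/-- The star centred at the vertex `0` is a non-crossing tree; in particular the uniform
distribution on `nonCrossingTrees n` makes sense. -/
theorem nonCrossingTrees_nonempty (n : ℕ) [NeZero n] : (nonCrossingTrees n).Nonempty := by
  have hn : (n : ℝ) ≠ 0 := Nat.cast_ne_zero.mpr (NeZero.ne n)
  have h0 : polygonVertex n 0 = 1 := by simp [polygonVertex]
  have hre : ∀ k : Fin n, polygonVertex n k =
      Complex.exp (((2 * Real.pi * ((k : ℕ) : ℝ) / (n : ℝ) : ℝ) : ℂ) * Complex.I) := by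
    intro k
    unfold polygonVertex
    congr 1
    push_cast
    ring
  have hsq : ∀ k : Fin n, (polygonVertex n k).re ^ 2 + (polygonVertex n k).im ^ 2 = 1 := by
    intro k
    rw [hre, Complex.exp_ofReal_mul_I_re, Complex.exp_ofReal_mul_I_im]
    exact Real.cos_sq_add_sin_sq _
  have hinj : Function.Injective (polygonVertex n) := by
    intro k l h
    have hn' : (n : ℂ) ≠ 0 := Nat.cast_ne_zero.mpr (NeZero.ne n)
    have := (Complex.isPrimitiveRoot_exp n (NeZero.ne n)).pow_inj k.2 l.2 (by
      rw [← Complex.exp_nat_mul, ← Complex.exp_nat_mul]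
      unfold polygonVertex at h
      convert h using 2 <;> ring)
    exact Fin.ext this
  -- two chords with the common end point `1`
  have key : ∀ u v : Fin n, u ≠ 0 → v ≠ 0 → u ≠ v →
      Disjoint (openSegment ℝ (1 : ℂ) (polygonVertex n u))
        (openSegment ℝ (1 : ℂ) (polygonVertex n v)) := by
    intro u v hu hv huv
    rw [Set.disjoint_left]
    rintro z ⟨s', s, hs', hs, hss, rfl⟩ ⟨t', t, ht', ht, htt, h⟩
    have hre1 := congrArg Complex.re h
    have him1 := congrArg Complex.im h
    have hu2 := hsq u
    have hv2 := hsq v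
    have hu1 : (polygonVertex n u).re ≠ 1 := by
      intro h1
      apply hu
      apply hinj
      rw [h0]
      apply Complex.ext
      · simpa using h1
      · rw [h1] at hu2
        have : (polygonVertex n u).im ^ 2 = 0 := by linarith
        simpa using this
    apply huv
    apply hinj
    set p := polygonVertex n u
    set q := polygonVertex n v
    simp at hre1 him1
    obtain rfl : s' = 1 - s := by linarith
    obtain rfl : t' = 1 - t := by linarith
    have h1 : t * (q.re - 1) = s * (p.re - 1) := by linarith
    have e1 : t ^ 2 * ((q.re - 1) ^ 2 + q.im ^ 2) = s ^ 2 * ((p.re - 1) ^ 2 + p.im ^ 2) := by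
      calc _ = (t * (q.re - 1)) ^ 2 + (t * q.im) ^ 2 := by ring
        _ = (s * (p.re - 1)) ^ 2 + (s * p.im) ^ 2 := by rw [h1, him1]
        _ = _ := by ring
    have e2 : (q.re - 1) ^ 2 + q.im ^ 2 = -2 * (q.re - 1) := by linarith
    have e3 : (p.re - 1) ^ 2 + p.im ^ 2 = -2 * (p.re - 1) := by linarith
    rw [e2, e3] at e1
    have e4 : (t - s) * (s * (p.re - 1)) = 0 := by
      have : t * (t * (q.re - 1)) = s * (s * (p.re - 1)) := by linarith
      rw [h1] at this
      linarith
    have e5 : s * (p.re - 1) ≠ 0 := mul_ne_zero hs.ne' (sub_ne_zero.mpr hu1)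
    have e6 : t = s := by
      rcases mul_eq_zero.mp e4 with h | h
      · linarith
      · exact absurd h e5
    subst e6
    apply Complex.ext
    · have := mul_left_cancel₀ hs.ne' h1
      linarith
    · exact (mul_left_cancel₀ hs.ne' him1).symm
  refine ⟨SimpleGraph.starGraph 0, SimpleGraph.isTree_starGraph 0, ?_⟩
  intro a b x y hab hxy hne
  rw [SimpleGraph.starGraph_adj] at hab hxy
  obtain ⟨hab, h1⟩ := hab
  obtain ⟨hxy, h2⟩ := hxy
  rcases h1 with rfl | rfl <;> rcases h2 with rfl | rfl
  · rw [h0]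
    exact key _ _ hab.symm hxy.symm (fun h => hne (by rw [h]))
  · rw [h0, openSegment_symm ℝ (polygonVertex n x)]
    exact key _ _ hab.symm hxy (fun h => hne (by rw [h, Sym2.eq_swap]))
  · rw [h0, openSegment_symm ℝ (polygonVertex n a)]
    exact key _ _ hab hxy.symm (fun h => hne (by rw [h, Sym2.eq_swap]))
  · rw [h0, openSegment_symm ℝ (polygonVertex n a), openSegment_symm ℝ (polygonVertex n x)]
    exact key _ _ hab hxy (fun h => hne (by rw [h]))

end NonCrossing

namespace NonCrossing

open SimpleGraph

/-! ### Non-crossing trees on an interval of integers -/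

/-! With m = n - 1, a non-crossing tree of the polygon is a tree on {0, …, m} without interlaced
edges. Cutting such a tree repeatedly at the largest neighbour of its root
(`IsIntervalTree.exists_join`) shows that these trees are counted like plane trees in which a
non-root vertex with d children has weight d + 1, the number of ways to place some of its children
on its left and the others on its right. Let P_k be the truncation at degree k of (1 - x)^(-2). By
Lagrange inversion, m times the number of trees with root degree r and all other outdegrees at most
k is r times the coefficient of x^(m - r) in P_k^m (`mul_treeCount`).

So the outdegrees behave like independent variables of law (4/9)(d + 1)3^(-d) conditioned on their
sum; x = 1/3 is the tilt that makes the mean equal to 1. The tail of this law beyond k has order k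
3^(-k), so about n k 3^(-k) vertices should have outdegree above k. This number passes through order
1 near k = log_3 n + log_3 log_3 n.

The upper tail is a union bound, made on coefficients: replacing one factor of the full power by the
tail of its series costs the tail weight, because the tilted coefficients increase up to the mode
(`boundedCount_upper`). For the lower tail the m factors of P_k^m are split into two halves. One
half is replaced by the full series and bounded by its largest tilted coefficient, which removes the
conditioning; the other half is then summed freely and gives P_k(1/3)^(m/2), an exponentially small
fraction of (9/4)^(m/2). A comparison of central coefficients shows that removing the conditioning
costs only a constant factor (`boundedCount_lower`). -/

theorem reachable_induction {V : Type*} {G : SimpleGraph V} {P : V → Prop}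
    (hP : ∀ x y, G.Adj x y → P x → P y) {a b : V} (hab : G.Reachable a b) (ha : P a) : P b := by
  obtain ⟨w⟩ := hab
  induction w with
  | nil => exact ha
  | cons h _ ih => exact ih (hP _ _ h ha)

/-- A graph on `ℤ` all of whose edges lie in the interval `[l, h]`. -/
def LivesOn (l h : ℤ) (G : SimpleGraph ℤ) : Prop :=
  ∀ ⦃x y⦄, G.Adj x y → l ≤ x ∧ x ≤ h

/-- Any two edges of the graph are not interlaced. -/
def NoInterlacing {V : Type*} [LT V] (G : SimpleGraph V) : Prop :=
  ∀ ⦃a b x y⦄, G.Adj a b → G.Adj x y → a < x → x < b → b < y → False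

/-- Non-crossing trees with vertex set the interval `[l, h]`. -/
structure IsIntervalTree (l h : ℤ) (G : SimpleGraph ℤ) : Prop where
  mem : LivesOn l h G
  reach : ∀ ⦃x y⦄, l ≤ x → x ≤ h → l ≤ y → y ≤ h → G.Reachable x y
  card : (G.edgeSet.ncard : ℤ) = h - l
  noncross : NoInterlacing G

theorem LivesOn.finite_edgeSet {l h : ℤ} {G : SimpleGraph ℤ} (hG : LivesOn l h G) :
    G.edgeSet.Finite := by
  refine (((Set.finite_Icc l h).prod (Set.finite_Icc l h)).image
    (fun p : ℤ × ℤ => s(p.1, p.2))).subset ?_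
  intro e
  induction e with
  | _ x y =>
    intro he
    exact ⟨(x, y), ⟨hG he, hG he.symm⟩, rfl⟩

theorem finite_livesOn (l h : ℤ) : {G | LivesOn l h G}.Finite := by
  refine Set.Finite.of_finite_image (f := SimpleGraph.edgeSet) ?_ edgeSet_injective.injOn
  refine (((Set.finite_Icc l h).prod (Set.finite_Icc l h)).image
    (fun p : ℤ × ℤ => s(p.1, p.2))).finite_subsets.subset ?_
  rintro _ ⟨G, hG, rfl⟩ e
  induction e with
  | _ x y =>
    intro he
    exact ⟨(x, y), ⟨hG he, hG he.symm⟩, rfl⟩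

/-- A connected graph has at least one edge fewer than vertices. This forces the edge counts when a
tree is cut into connected pieces. -/
theorem LivesOn.le_ncard_edgeSet {l h : ℤ} {G : SimpleGraph ℤ} (hG : LivesOn l h G) (hlh : l ≤ h)
    (hr : ∀ ⦃x⦄, l ≤ x → x ≤ h → G.Reachable l x) : h - l ≤ G.edgeSet.ncard := by
  have hc : (G.induce (Set.Icc l h)).Connected := by
    have h1 : ∀ x : Set.Icc l h, (G.induce (Set.Icc l h)).Reachable ⟨l, le_rfl, hlh⟩ x := by
      intro x
      refine reachable_induction
        (P := fun y => ∀ hy : y ∈ Set.Icc l h,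
          (G.induce (Set.Icc l h)).Reachable ⟨l, le_rfl, hlh⟩ ⟨y, hy⟩) ?_ (hr x.2.1 x.2.2)
        (fun _ => Reachable.refl _) x.2
      intro y z hyz hy hz
      exact (hy (hG hyz)).trans (Adj.reachable (induce_adj.2 hyz))
    have : Nonempty (Set.Icc l h) := ⟨⟨l, le_rfl, hlh⟩⟩
    exact ⟨fun x y => (h1 x).symm.trans (h1 y)⟩
  have h2 := hc.card_vert_le_card_edgeSet_add_one
  have h3 : Nat.card (G.induce (Set.Icc l h)).edgeSet ≤ G.edgeSet.ncard := by
    rw [Nat.card_coe_set_eq]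
    refine Set.ncard_le_ncard_of_injOn (Sym2.map Subtype.val) ?_
      (Sym2.map.injective Subtype.val_injective).injOn hG.finite_edgeSet
    intro e
    induction e with
    | _ x y => intro he; exact he
  rw [Nat.card_eq_fintype_card, Fintype.card_ofFinset, Int.card_Icc] at h2
  omega

/-- Three graphs on consecutive intervals, joined by the edge `{l, v}`. -/
def join (l v : ℤ) (A B C : SimpleGraph ℤ) : SimpleGraph ℤ := A ⊔ B ⊔ C ⊔ edge l v

theorem join_adj {l v : ℤ} (hlv : l ≠ v) {A B C : SimpleGraph ℤ} {x y : ℤ} :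
    (join l v A B C).Adj x y ↔
      A.Adj x y ∨ B.Adj x y ∨ C.Adj x y ∨ (x = l ∧ y = v) ∨ (x = v ∧ y = l) := by
  simp only [join, sup_adj, edge_adj]
  grind

theorem ncard_edgeSet_join {l j v h : ℤ} (hj : l ≤ j) (hv : j < v)
    {A B C : SimpleGraph ℤ} (hA : LivesOn l j A) (hB : LivesOn (j + 1) v B) (hC : LivesOn v h C) :
    (join l v A B C).edgeSet.ncard =
      A.edgeSet.ncard + B.edgeSet.ncard + C.edgeSet.ncard + 1 := by
  have hlv : l ≠ v := by omega
  have e : (join l v A B C).edgeSet = insert s(l, v) (A.edgeSet ∪ B.edgeSet ∪ C.edgeSet) := by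
    ext e
    induction e with
    | _ x y =>
      simp only [mem_edgeSet, join_adj hlv, Set.mem_insert_iff, Set.mem_union, Sym2.eq_iff]
      tauto
  have fA := hA.finite_edgeSet
  have fB := hB.finite_edgeSet
  have fC := hC.finite_edgeSet
  have d1 : Disjoint A.edgeSet B.edgeSet := by
    rw [Set.disjoint_left]
    intro e
    induction e with
    | _ x y => intro h1 h2; have := hA h1; have := hB h2; omega
  have d2 : Disjoint (A.edgeSet ∪ B.edgeSet) C.edgeSet := by
    rw [Set.disjoint_left]
    intro e
    induction e with
    | _ x y =>
      rintro (h1 | h1) h2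
      · have := hA h1; have := hC h2; omega
      · have := hB h1; have := hC h2; have := hB h1.symm; have := hC h2.symm
        exact h1.ne (by omega)
  rw [e, Set.ncard_insert_of_notMem _ ((fA.union fB).union fC),
    Set.ncard_union_eq d2 (fA.union fB) fC, Set.ncard_union_eq d1 fA fB]
  rintro ((h1 | h1) | h1)
  · have := hA (Adj.symm h1); omega
  · have := hB h1; omega
  · have := hC h1; omega

theorem IsIntervalTree.join {l j v h : ℤ} (hj : l ≤ j) (hv : j < v) (hh : v ≤ h)
    {A B C : SimpleGraph ℤ} (hA : IsIntervalTree l j A) (hB : IsIntervalTree (j + 1) v B)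
    (hC : IsIntervalTree v h C) : IsIntervalTree l h (join l v A B C) := by
  have hlv : l ≠ v := by omega
  refine ⟨?_, ?_, ?_, ?_⟩
  · intro x y hxy
    rcases (join_adj hlv).1 hxy with h | h | h | h | h
    · have := hA.mem h; omega
    · have := hB.mem h; omega
    · have := hC.mem h; omega
    · omega
    · omega
  · have hlv' : (NonCrossing.join l v A B C).Reachable l v :=
      Adj.reachable ((join_adj hlv).2 (by simp))
    have h1 : ∀ x, l ≤ x → x ≤ h → (NonCrossing.join l v A B C).Reachable l x := by
      intro x hx hx'
      by_cases h1 : x ≤ j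
      · exact (hA.reach le_rfl hj hx h1).mono (fun x y h => (join_adj hlv).2 (by tauto))
      · refine hlv'.trans ?_
        by_cases h2 : x ≤ v
        · exact (hB.reach (by omega) le_rfl (by omega) h2).mono
            (fun x y h => (join_adj hlv).2 (by tauto))
        · exact (hC.reach le_rfl hh (by omega) hx').mono
            (fun x y h => (join_adj hlv).2 (by tauto))
    intro x y hx hx' hy hy'
    exact (h1 x hx hx').symm.trans (h1 y hy hy')
  · rw [ncard_edgeSet_join hj hv hA.mem hB.mem hC.mem]
    have := hA.card
    have := hB.card
    have := hC.card
    push_cast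
    omega
  · intro a b x y hab hxy h1 h2 h3
    rcases (join_adj hlv).1 hab with p | p | p | p | p <;>
    rcases (join_adj hlv).1 hxy with q | q | q | q | q
    · exact hA.noncross p q h1 h2 h3
    · have := hA.mem p; have := hA.mem p.symm; have := hB.mem q; omega
    · have := hA.mem p; have := hA.mem p.symm; have := hC.mem q; omega
    · have := hA.mem p; have := hA.mem p.symm; omega
    · have := hA.mem p; have := hA.mem p.symm; omega
    · have := hB.mem p; have := hB.mem p.symm; have := hA.mem q; have := hA.mem q.symm; omega
    · exact hB.noncross p q h1 h2 h3
    · have := hB.mem p; have := hB.mem p.symm; have := hC.mem q; have := hC.mem q.symm; omega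
    · have := hB.mem p; have := hB.mem p.symm; omega
    · have := hB.mem p; have := hB.mem p.symm; omega
    · have := hC.mem p; have := hC.mem p.symm; have := hA.mem q; have := hA.mem q.symm; omega
    · have := hC.mem p; have := hC.mem p.symm; have := hB.mem q; have := hB.mem q.symm; omega
    · exact hC.noncross p q h1 h2 h3
    · have := hC.mem p; have := hC.mem p.symm; omega
    · have := hC.mem p; have := hC.mem p.symm; omega
    · have := hA.mem q; have := hA.mem q.symm; omega
    · have := hB.mem q; have := hB.mem q.symm; omega
    · have := hC.mem q; have := hC.mem q.symm; omega
    · omega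
    · omega
    · have := hA.mem q; have := hA.mem q.symm; omega
    · have := hB.mem q; have := hB.mem q.symm; omega
    · have := hC.mem q; have := hC.mem q.symm; omega
    · omega
    · omega

theorem IsIntervalTree.exists_crossing_edge {l h : ℤ} {G : SimpleGraph ℤ}
    (hG : IsIntervalTree l h G) {j : ℤ} (hj : l ≤ j) (hj' : j < h) :
    ∃ x y, x ≤ j ∧ j < y ∧ G.Adj x y := by
  by_contra! hcon
  have := reachable_induction (P := fun x => x ≤ j) (fun x y hxy hx => by
    by_contra h
    exact hcon x y hx (by omega) hxy) (hG.reach le_rfl (by omega) (by omega) le_rfl) hj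
  omega

/-- The vertex `v` is recovered as the largest neighbour of `l`. If `j < j'`, connectedness of `A'`
gives an edge inside `[l, j']` across the gap after `j`; but in the first join only `{l, v}` crosses
that gap, and `v` lies beyond `j'`. The three pieces are then read off from the intervals. -/
theorem join_injective {l j v h j' v' : ℤ} (hj : l ≤ j) (hv : j < v)
    {A B C A' B' C' : SimpleGraph ℤ} (hA : IsIntervalTree l j A)
    (hB : IsIntervalTree (j + 1) v B) (hC : IsIntervalTree v h C) (hj' : l ≤ j') (hv' : j' < v')
    (hA' : IsIntervalTree l j' A') (hB' : IsIntervalTree (j' + 1) v' B')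
    (hC' : IsIntervalTree v' h C') (heq : join l v A B C = join l v' A' B' C') :
    j = j' ∧ v = v' ∧ A = A' ∧ B = B' ∧ C = C' := by
  have hlv : l ≠ v := by omega
  have hlv' : l ≠ v' := by omega
  have hadj : ∀ x y, (join l v A B C).Adj x y ↔ (join l v' A' B' C').Adj x y := by
    intro x y; rw [heq]
  simp only [join_adj hlv, join_adj hlv'] at hadj
  have aA := hA.mem; have aB := hB.mem; have aC := hC.mem
  have aA' := hA'.mem; have aB' := hB'.mem; have aC' := hC'.mem
  obtain rfl : v = v' := by
    have e1 := (hadj l v).1 (by simp)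
    have e2 := (hadj l v').2 (by simp)
    have c1 : v ≤ v' := by
      rcases e1 with h | h | h | h | h
      · have := aA' h.symm; omega
      · have := aB' h; omega
      · have := aC' h; omega
      · omega
      · omega
    have c2 : v' ≤ v := by
      rcases e2 with h | h | h | h | h
      · have := aA h.symm; omega
      · have := aB h; omega
      · have := aC h; omega
      · omega
      · omega
    omega
  obtain rfl : j = j' := by
    rcases lt_trichotomy j j' with hlt | rfl | hlt
    · obtain ⟨x, y, hx, hy, hxy⟩ := hA'.exists_crossing_edge hj hlt
      have m1 := aA' hxy; have m2 := aA' hxy.symm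
      rcases (hadj x y).2 (Or.inl hxy) with h | h | h | h | h
      · have := aA h.symm; omega
      · have := aB h; omega
      · have := aC h; omega
      · omega
      · omega
    · rfl
    · obtain ⟨x, y, hx, hy, hxy⟩ := hA.exists_crossing_edge hj' hlt
      have m1 := aA hxy; have m2 := aA hxy.symm
      rcases (hadj x y).1 (Or.inl hxy) with h | h | h | h | h
      · have := aA' h.symm; omega
      · have := aB' h; omega
      · have := aC' h; omega
      · omega
      · omega
  refine ⟨rfl, rfl, ?_, ?_, ?_⟩
  · ext x y
    constructor
    · intro h
      have m1 := aA h; have m2 := aA h.symm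
      rcases (hadj x y).1 (Or.inl h) with h | h | h | h | h
      · exact h
      · have := aB' h; omega
      · have := aC' h; omega
      · omega
      · omega
    · intro h
      have m1 := aA' h; have m2 := aA' h.symm
      rcases (hadj x y).2 (Or.inl h) with h | h | h | h | h
      · exact h
      · have := aB h; omega
      · have := aC h; omega
      · omega
      · omega
  · ext x y
    constructor
    · intro h
      have m1 := aB h; have m2 := aB h.symm
      have := h.ne
      rcases (hadj x y).1 (Or.inr (Or.inl h)) with h | h | h | h | h
      · have := aA' h; omega
      · exact h
      · have := aC' h; have := aC' h.symm; omega
      · omega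
      · omega
    · intro h
      have m1 := aB' h; have m2 := aB' h.symm
      have := h.ne
      rcases (hadj x y).2 (Or.inr (Or.inl h)) with h | h | h | h | h
      · have := aA h; omega
      · exact h
      · have := aC h; have := aC h.symm; omega
      · omega
      · omega
  · ext x y
    constructor
    · intro h
      have m1 := aC h; have m2 := aC h.symm
      have := h.ne
      rcases (hadj x y).1 (Or.inr (Or.inr (Or.inl h))) with h | h | h | h | h
      · have := aA' h; omega
      · have := aB' h; have := aB' h.symm; omega
      · exact h
      · omega
      · omega
    · intro h
      have m1 := aC' h; have m2 := aC' h.symm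
      have := h.ne
      rcases (hadj x y).2 (Or.inr (Or.inr (Or.inl h))) with h | h | h | h | h
      · have := aA h; omega
      · have := aB h; have := aB h.symm; omega
      · exact h
      · omega
      · omega

end NonCrossing

/-! ### Cutting an interval tree at the largest neighbour of its first vertex -/

namespace NonCrossing

open SimpleGraph

/-- The part of a graph on `ℤ` inside the interval `[l, h]`. -/
def restrictTo (l h : ℤ) (G : SimpleGraph ℤ) : SimpleGraph ℤ where
  Adj x y := G.Adj x y ∧ l ≤ x ∧ x ≤ h ∧ l ≤ y ∧ y ≤ h
  symm := ⟨fun _ _ h => ⟨h.1.symm, h.2.2.2.1, h.2.2.2.2, h.2.1, h.2.2.1⟩⟩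
  loopless := ⟨fun _ h => h.1.ne rfl⟩

theorem restrictTo_adj {l h : ℤ} {G : SimpleGraph ℤ} {x y : ℤ} :
    (restrictTo l h G).Adj x y ↔ G.Adj x y ∧ l ≤ x ∧ x ≤ h ∧ l ≤ y ∧ y ≤ h := Iff.rfl

theorem livesOn_restrictTo (l h : ℤ) (G : SimpleGraph ℤ) : LivesOn l h (restrictTo l h G) :=
  fun _ _ hxy => ⟨hxy.2.1, hxy.2.2.1⟩

theorem NoInterlacing.mono {V : Type*} [LT V] {G H : SimpleGraph V} (hG : NoInterlacing G)
    (h : H ≤ G) : NoInterlacing H :=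
  fun _ _ _ _ hab hxy => hG (h hab) (h hxy)

/-- The discrete Jordan curve argument: if `p < y < q < z` and no two edges are interlaced then
`p, q` and `y, z` cannot be joined by paths in two different components. -/
theorem NoInterlacing.reachable {V : Type*} [LinearOrder V] {G : SimpleGraph V}
    (hG : NoInterlacing G) {p y q z : V} (hpy : p < y) (hyq : y < q) (hqz : q < z)
    (hpq : G.Reachable p q) (hyz : G.Reachable y z) : G.Reachable p y := by
  by_contra hcon
  -- No vertex of the component of `p` is an end of the edge `st`, so an edge of that component
  -- cannot enter or leave the open interval `(s, t)` without being interlaced with `st`. Hence `p`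
  -- and `q` lie on the same side of `st`.
  have side : ∀ s t, G.Reachable y s → G.Adj s t → s < t →
      ((s < p ∧ p < t) ↔ (s < q ∧ q < t)) := by
    intro s t hs hst hlt
    have h : ∀ x, G.Reachable p x → x ≠ s ∧ x ≠ t := by
      intro x hx
      constructor
      · rintro rfl; exact hcon (hx.trans hs.symm)
      · rintro rfl; exact hcon (hx.trans (hs.trans hst.reachable).symm)
    have := reachable_induction
      (P := fun x => G.Reachable p x ∧ ((s < p ∧ p < t) ↔ (s < x ∧ x < t))) (fun a b hab ha => by
        refine ⟨ha.1.trans hab.reachable, ha.2.trans ?_⟩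
        have ne := h a ha.1
        have ne' := h b (ha.1.trans hab.reachable)
        constructor
        · intro ⟨h1, h2⟩
          constructor
          · by_contra h3
            have h3 := lt_of_le_of_ne (not_lt.1 h3) ne'.1
            exact hG hab.symm hst h3 h1 h2
          · by_contra h3
            have h3 := lt_of_le_of_ne (not_lt.1 h3) (Ne.symm ne'.2)
            exact hG hst hab h1 h2 h3
        · intro ⟨h1, h2⟩
          constructor
          · by_contra h3
            have h3 := lt_of_le_of_ne (not_lt.1 h3) ne.1
            exact hG hab hst h3 h1 h2
          · by_contra h3
            have h3 := lt_of_le_of_ne (not_lt.1 h3) (Ne.symm ne.2)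
            exact hG hst hab.symm h1 h2 h3) hpq ⟨Reachable.refl _, Iff.rfl⟩
    exact this.2
  have hne : ∀ x, G.Reachable y x → x ≠ p ∧ x ≠ q := by
    intro x hx
    constructor
    · rintro rfl; exact hcon hx.symm
    · rintro rfl; exact hcon (hpq.trans hx.symm)
  -- An edge leading out of `(p, q)` would have exactly one of `p`, `q` under it, against `side`. So
  -- the component of `y` is trapped in `(p, q)` and cannot contain `z`.
  have key : ∀ s t, G.Reachable y s → G.Adj s t → p < s → s < q → p < t ∧ t < q := by
    intro s t hs hst h1 h2
    have ne := hne t (hs.trans hst.reachable)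
    rcases lt_or_gt_of_ne hst.ne with hlt | hlt
    · have h3 := (side s t hs hst hlt)
      refine ⟨h1.trans hlt, ?_⟩
      by_contra h4
      have h4 := lt_of_le_of_ne (not_lt.1 h4) (Ne.symm ne.2)
      exact absurd (h3.2 ⟨h2, h4⟩).1 (not_lt.2 h1.le)
    · have h3 := (side t s (hs.trans hst.reachable) hst.symm hlt)
      refine ⟨?_, hlt.trans h2⟩
      by_contra h4
      have h4 := lt_of_le_of_ne (not_lt.1 h4) ne.1
      exact absurd (h3.1 ⟨h4, h1⟩).2 (not_lt.2 h2.le)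
  have := reachable_induction (P := fun x => G.Reachable y x ∧ p < x ∧ x < q)
    (fun a b hab ha => ⟨ha.1.trans hab.reachable, key a b ha.1 hab ha.2.1 ha.2.2⟩) hyz
    ⟨Reachable.refl _, hpy, hyq⟩
  exact absurd this.2.2 (not_lt.2 hqz.le)

/-- Otherwise the graph would remain connected with one edge too few. -/
theorem IsIntervalTree.not_reachable_deleteEdges {l h : ℤ} {G : SimpleGraph ℤ}
    (hG : IsIntervalTree l h G) {v : ℤ} (hv : G.Adj l v) :
    ¬ (G.deleteEdges {s(l, v)}).Reachable l v := by
  intro hr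
  have hl := hG.mem hv
  have h1 : LivesOn l h (G.deleteEdges {s(l, v)}) := fun x y hxy => hG.mem (deleteEdges_le _ hxy)
  have h2 := h1.le_ncard_edgeSet (by omega) (fun x hx hx' => by
    refine reachable_induction (fun a b hab ha => ?_) (hG.reach le_rfl (by omega) hx hx')
      (Reachable.refl l)
    by_cases he : s(a, b) = s(l, v)
    · rw [Sym2.eq_iff] at he
      rcases he with ⟨rfl, rfl⟩ | ⟨rfl, rfl⟩
      · exact hr
      · exact Reachable.refl _
    · exact ha.trans (Adj.reachable (by simp [deleteEdges_adj, hab, he])))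
  rw [edgeSet_deleteEdges, Set.ncard_sdiff_singleton_of_mem (by exact hv)] at h2
  have h3 := hG.card
  have h4 : 0 < G.edgeSet.ncard :=
    (Set.ncard_pos hG.mem.finite_edgeSet).2 ⟨s(l, v), hv⟩
  omega

/-- Let `v` be the largest neighbour of `l` and delete the edge `{l, v}`. The component of `l` is an
initial interval `[l, j]` by the discrete Jordan argument. No remaining edge passes over `v`, so the
component of `v` splits at `v` into a left and a right part. -/
theorem IsIntervalTree.exists_join {l h : ℤ} {G : SimpleGraph ℤ} (hG : IsIntervalTree l h G)
    (hlh : l < h) : ∃ j v A B C, l ≤ j ∧ j < v ∧ v ≤ h ∧ IsIntervalTree l j A ∧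
      IsIntervalTree (j + 1) v B ∧ IsIntervalTree v h C ∧ G = NonCrossing.join l v A B C := by
  have hnb : ∃ v, G.Adj l v := by
    obtain ⟨x, y, hx, hy, hxy⟩ := hG.exists_crossing_edge le_rfl hlh
    obtain rfl : x = l := by have := hG.mem hxy; omega
    exact ⟨y, hxy⟩
  obtain ⟨v, hv, hmax⟩ := Int.exists_greatest_of_bdd ⟨h, fun z hz => (hG.mem (Adj.symm hz)).2⟩ hnb
  have hvm := hG.mem hv.symm
  have hlv : l < v := lt_of_le_of_ne hvm.1 hv.ne
  set G' := G.deleteEdges {s(l, v)} with hG'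
  have hG'le : G' ≤ G := deleteEdges_le _
  have hG'adj : ∀ {x y}, G'.Adj x y ↔ G.Adj x y ∧ ¬ ((x = l ∧ y = v) ∨ (x = v ∧ y = l)) := by
    intro x y
    simp [hG', deleteEdges_adj]
  have hnr : ¬ G'.Reachable l v := hG.not_reachable_deleteEdges hv
  have hor : ∀ x, l ≤ x → x ≤ h → G'.Reachable l x ∨ G'.Reachable v x := by
    intro x hx hx'
    refine reachable_induction (P := fun x => G'.Reachable l x ∨ G'.Reachable v x)
      (fun a b hab ha => ?_) (hG.reach le_rfl hlh.le hx hx') (Or.inl (Reachable.refl _))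
    by_cases he : (a = l ∧ b = v) ∨ (a = v ∧ b = l)
    · rcases he with ⟨rfl, rfl⟩ | ⟨rfl, rfl⟩
      · exact Or.inr (Reachable.refl _)
      · exact Or.inl (Reachable.refl _)
    · have : G'.Adj a b := hG'adj.2 ⟨hab, he⟩
      exact ha.imp (fun h => h.trans this.reachable) (fun h => h.trans this.reachable)
  -- An edge over `v` starts either at `l`, against the maximality of `v`, or to the right of `l`,
  -- and then it is interlaced with `{l, v}`.
  have hstraddle : ∀ x y, G'.Adj x y → x < v → v < y → False := by
    intro x y hxy h1 h2
    have hxm := hG.mem (hG'le hxy)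
    rcases eq_or_lt_of_le hxm.1 with rfl | h3
    · have := hmax y (hG'le hxy); omega
    · exact hG.noncross hv (hG'le hxy) h3 h1 h2
  have hbelow : ∀ x, G'.Reachable l x → l ≤ x ∧ x < v := by
    intro x hx
    refine (reachable_induction (P := fun x => G'.Reachable l x ∧ l ≤ x ∧ x < v)
      (fun a b hab ha => ?_) hx ⟨Reachable.refl _, le_rfl, hlv⟩).2
    have hb : G'.Reachable l b := ha.1.trans hab.reachable
    refine ⟨hb, (hG.mem (hG'le hab.symm)).1, ?_⟩
    rcases lt_trichotomy b v with h1 | rfl | h1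
    · exact h1
    · exact absurd hb hnr
    · exact absurd h1 (fun h1 => hstraddle a b hab ha.2.2 h1)
  obtain ⟨j, hj, hjmax⟩ := Int.exists_greatest_of_bdd (P := fun x => G'.Reachable l x)
    ⟨v, fun z hz => (hbelow z hz).2.le⟩ ⟨l, Reachable.refl _⟩
  have hjb := hbelow j hj
  have hG'nc : NoInterlacing G' := hG.noncross.mono hG'le
  -- A vertex between `l` and `j` in the component of `v` would give the forbidden configuration `l
  -- < x < j < v`.
  have hiff : ∀ x, l ≤ x → (G'.Reachable l x ↔ x ≤ j) := by
    intro x hx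
    refine ⟨fun h => hjmax x h, fun hxj => ?_⟩
    rcases eq_or_lt_of_le hx with rfl | h1
    · exact Reachable.refl _
    rcases eq_or_lt_of_le hxj with rfl | h2
    · exact hj
    rcases hor x hx (by omega) with h3 | h3
    · exact h3
    · exact hG'nc.reachable h1 h2 hjb.2 hj h3.symm
  have hsame : ∀ x y, G'.Adj x y → (x ≤ j ↔ y ≤ j) := by
    intro x y hxy
    rw [← hiff x (hG.mem (hG'le hxy)).1, ← hiff y (hG.mem (hG'le hxy.symm)).1]
    exact ⟨fun h => h.trans hxy.reachable, fun h => h.trans hxy.symm.reachable⟩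
  set A := restrictTo l j G' with hA
  set B := restrictTo (j + 1) v G' with hB
  set C := restrictTo v h G' with hC
  have heq : G = NonCrossing.join l v A B C := by
    ext x y
    rw [join_adj hlv.ne]
    constructor
    · intro hxy
      by_cases he : (x = l ∧ y = v) ∨ (x = v ∧ y = l)
      · tauto
      have hxy' : G'.Adj x y := hG'adj.2 ⟨hxy, he⟩
      have m1 := hG.mem hxy
      have m2 := hG.mem hxy.symm
      have h1 := hsame x y hxy'
      have h2 : ¬ (x < v ∧ v < y) := fun h => hstraddle x y hxy' h.1 h.2
      have h3 : ¬ (y < v ∧ v < x) := fun h => hstraddle y x hxy'.symm h.1 h.2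
      simp only [hA, hB, hC, restrictTo_adj, hxy', true_and]
      by_contra hcon
      omega
    · rintro (h1 | h1 | h1 | ⟨rfl, rfl⟩ | ⟨rfl, rfl⟩)
      · exact hG'le h1.1
      · exact hG'le h1.1
      · exact hG'le h1.1
      · exact hv
      · exact hv.symm
  have rA : ∀ x, l ≤ x → x ≤ j → A.Reachable l x := by
    intro x hx hxj
    refine (reachable_induction (P := fun x => x ≤ j ∧ A.Reachable l x)
      (fun a b hab ha => ?_) ((hiff x hx).2 hxj) ⟨hjb.1, Reachable.refl _⟩).2
    have hb := (hsame a b hab).1 ha.1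
    exact ⟨hb, ha.2.trans (Adj.reachable
      ⟨hab, (hG.mem (hG'le hab)).1, ha.1, (hG.mem (hG'le hab.symm)).1, hb⟩)⟩
  have rBC : ∀ x, l ≤ x → x ≤ h → j < x →
      (x ≤ v → B.Reachable v x) ∧ (v ≤ x → C.Reachable v x) := by
    intro x hx hxh hjx
    have hvx : G'.Reachable v x := by
      rcases hor x hx hxh with h1 | h1
      · have := hjmax x h1; omega
      · exact h1
    refine (reachable_induction (P := fun x => j < x ∧ (x ≤ v → B.Reachable v x) ∧
      (v ≤ x → C.Reachable v x)) (fun a b hab ha => ?_) hvx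
      ⟨hjb.2, fun _ => Reachable.refl _, fun _ => Reachable.refl _⟩).2
    have m1 := hG.mem (hG'le hab)
    have m2 := hG.mem (hG'le hab.symm)
    have hs := hsame a b hab
    have h2 := hstraddle a b hab
    have h3 := hstraddle b a hab.symm
    refine ⟨by omega, fun h4 => ?_, fun h4 => ?_⟩
    · rcases eq_or_lt_of_le h4 with rfl | h5
      · exact Reachable.refl _
      · have h6 : a ≤ v := by by_contra h6; exact h3 h5 (by omega)
        exact (ha.2.1 h6).trans (Adj.reachable ⟨hab, by omega, h6, by omega, h4⟩)
    · rcases eq_or_lt_of_le h4 with rfl | h5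
      · exact Reachable.refl _
      · have h6 : v ≤ a := by by_contra h6; exact h2 (by omega) h5
        exact (ha.2.2 h6).trans (Adj.reachable ⟨hab, h6, m1.2, h4, m2.2⟩)
  have rB : ∀ x, j + 1 ≤ x → x ≤ v → B.Reachable v x := fun x h1 h2 =>
    (rBC x (by omega) (by omega) (by omega)).1 h2
  have rC : ∀ x, v ≤ x → x ≤ h → C.Reachable v x := fun x h1 h2 =>
    (rBC x (by omega) (by omega) (by omega)).2 h1
  have lA := livesOn_restrictTo l j G'
  have lB := livesOn_restrictTo (j + 1) v G'
  have lC := livesOn_restrictTo v h G'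
  have n := ncard_edgeSet_join hjb.1 hjb.2 lA lB lC
  -- The three lower bounds add up to `h - l - 1`, exactly the number of edges left after deleting
  -- `{l, v}`, so all of them are equalities.
  have nA := lA.le_ncard_edgeSet hjb.1 (fun x => rA x)
  have nB := lB.le_ncard_edgeSet hjb.2 (fun x h1 h2 =>
    (rB _ le_rfl hjb.2).symm.trans (rB x h1 h2))
  have nC := lC.le_ncard_edgeSet hvm.2 (fun x => rC x)
  have hcard := hG.card
  rw [← hA, ← hB, ← hC] at n
  rw [← hA] at nA
  rw [← hB] at nB
  rw [← hC] at nC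
  rw [heq, n] at hcard
  push_cast at hcard
  refine ⟨j, v, A, B, C, hjb.1, hjb.2, hvm.2, ⟨lA, ?_, by omega, ?_⟩, ⟨lB, ?_, by omega, ?_⟩,
    ⟨lC, ?_, by omega, ?_⟩, heq⟩
  · exact fun x y h1 h2 h3 h4 => (rA x h1 h2).symm.trans (rA y h3 h4)
  · exact hG'nc.mono (fun _ _ h => h.1)
  · exact fun x y h1 h2 h3 h4 => (rB x h1 h2).symm.trans (rB y h3 h4)
  · exact hG'nc.mono (fun _ _ h => h.1)
  · exact fun x y h1 h2 h3 h4 => (rC x h1 h2).symm.trans (rC y h3 h4)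
  · exact hG'nc.mono (fun _ _ h => h.1)

end NonCrossing

namespace NonCrossing

open SimpleGraph

/-! ### Degrees -/

/-- The number of neighbours of a vertex. -/
noncomputable def deg {V : Type*} (G : SimpleGraph V) (x : V) : ℕ := (G.neighborSet x).ncard

theorem LivesOn.finite_neighborSet {l h : ℤ} {G : SimpleGraph ℤ} (hG : LivesOn l h G) (x : ℤ) :
    (G.neighborSet x).Finite :=
  (Set.finite_Icc l h).subset (fun _ hy => hG (Adj.symm hy))

theorem LivesOn.deg_eq_zero {l h : ℤ} {G : SimpleGraph ℤ} (hG : LivesOn l h G) {x : ℤ}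
    (hx : x < l ∨ h < x) : deg G x = 0 := by
  have : G.neighborSet x = ∅ := by
    ext y
    simp only [mem_neighborSet, Set.mem_empty_iff_false, iff_false]
    intro hxy
    have := hG hxy
    omega
  simp [deg, this]

theorem deg_join_left {l j v h : ℤ} (hj : l ≤ j) (hv : j < v) {A B C : SimpleGraph ℤ}
    (hA : LivesOn l j A) (hB : LivesOn (j + 1) v B) (hC : LivesOn v h C) :
    deg (join l v A B C) l = deg A l + 1 := by
  have e : (join l v A B C).neighborSet l = insert v (A.neighborSet l) := by
    ext y
    simp only [mem_neighborSet, join_adj (show l ≠ v by omega), Set.mem_insert_iff]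
    constructor
    · rintro (h | h | h | h | h)
      · exact Or.inr h
      · have := hB h; omega
      · have := hC h; omega
      · exact Or.inl h.2
      · omega
    · rintro (h | h) <;> simp [h]
  rw [deg, e, Set.ncard_insert_of_notMem _ (hA.finite_neighborSet l), deg]
  intro h
  have := hA (Adj.symm h)
  omega

theorem deg_join_of_le {l j v h : ℤ} (hj : l ≤ j) (hv : j < v) {A B C : SimpleGraph ℤ}
    (hB : LivesOn (j + 1) v B) (hC : LivesOn v h C) {x : ℤ} (hx : x ≠ l) (hxj : x ≤ j) :
    deg (join l v A B C) x = deg A x := by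
  have e : (join l v A B C).neighborSet x = A.neighborSet x := by
    ext y
    simp only [mem_neighborSet, join_adj (show l ≠ v by omega)]
    constructor
    · rintro (h | h | h | h | h)
      · exact h
      · have := hB h; omega
      · have := hC h; omega
      · omega
      · omega
    · exact Or.inl
  rw [deg, e, deg]

theorem deg_join_of_lt_of_lt {l j v h : ℤ} (hj : l ≤ j) (hv : j < v) {A B C : SimpleGraph ℤ}
    (hA : LivesOn l j A) (hC : LivesOn v h C) {x : ℤ} (hx : j < x) (hxv : x < v) :
    deg (join l v A B C) x = deg B x := by
  have e : (join l v A B C).neighborSet x = B.neighborSet x := by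
    ext y
    simp only [mem_neighborSet, join_adj (show l ≠ v by omega)]
    constructor
    · rintro (h | h | h | h | h)
      · have := hA h; omega
      · exact h
      · have := hC h; omega
      · omega
      · omega
    · exact fun h => Or.inr (Or.inl h)
  rw [deg, e, deg]

theorem deg_join_of_gt {l j v : ℤ} (hj : l ≤ j) (hv : j < v) {A B C : SimpleGraph ℤ}
    (hA : LivesOn l j A) (hB : LivesOn (j + 1) v B) {x : ℤ} (hx : v < x) : deg (join l v A B C) x = deg C x := by
  have e : (join l v A B C).neighborSet x = C.neighborSet x := by
    ext y
    simp only [mem_neighborSet, join_adj (show l ≠ v by omega)]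
    constructor
    · rintro (h | h | h | h | h)
      · have := hA h; omega
      · have := hB h; omega
      · exact h
      · omega
      · omega
    · exact fun h => Or.inr (Or.inr (Or.inl h))
  rw [deg, e, deg]

theorem deg_join_joint {l j v h : ℤ} (hj : l ≤ j) (hv : j < v) {A B C : SimpleGraph ℤ}
    (hA : LivesOn l j A) (hB : LivesOn (j + 1) v B) (hC : LivesOn v h C) :
    deg (join l v A B C) v = deg B v + deg C v + 1 := by
  have e : (join l v A B C).neighborSet v =
      insert l (B.neighborSet v ∪ C.neighborSet v) := by
    ext y
    simp only [mem_neighborSet, join_adj (show l ≠ v by omega), Set.mem_insert_iff, Set.mem_union]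
    constructor
    · rintro (h | h | h | h | h)
      · have := hA h; omega
      · tauto
      · tauto
      · omega
      · tauto
    · tauto
  have fB := hB.finite_neighborSet v
  have fC := hC.finite_neighborSet v
  rw [deg, e, Set.ncard_insert_of_notMem _ (fB.union fC), Set.ncard_union_eq _ fB fC, deg, deg]
  · rw [Set.disjoint_left]
    intro y h1 h2
    have m1 := hB (Adj.symm h1)
    have m2 := hC (Adj.symm h2)
    exact (Adj.ne h1) (by omega)
  · rintro (h | h)
    · have := hB (Adj.symm h); omega
    · have := hC (Adj.symm h); omega

/-! ### Shifts and reflections -/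

theorem IsIntervalTree.comap {l h l' h' : ℤ} {G : SimpleGraph ℤ} (hG : IsIntervalTree l h G)
    (e : ℤ ≃ ℤ) (he : ∀ x, (l' ≤ x ∧ x ≤ h') ↔ (l ≤ e x ∧ e x ≤ h)) (hl : h' - l' = h - l)
    (hm : (∀ x y, x < y → e x < e y) ∨ (∀ x y, x < y → e y < e x)) :
    IsIntervalTree l' h' (G.comap e) := by
  refine ⟨fun x y hxy => (he x).2 (hG.mem hxy), fun x y h1 h2 h3 h4 => ?_, ?_, ?_⟩
  · rw [← (Iso.comap e G).reachable_iff]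
    obtain ⟨m1, m2⟩ := (he x).1 ⟨h1, h2⟩
    obtain ⟨m3, m4⟩ := (he y).1 ⟨h3, h4⟩
    exact hG.reach m1 m2 m3 m4
  · rw [hl, ← hG.card, ← Nat.card_coe_set_eq, ← Nat.card_coe_set_eq,
      Nat.card_congr (Iso.comap e G).mapEdgeSet]
  · intro a b x y hab hxy h1 h2 h3
    rcases hm with hm | hm
    · exact hG.noncross hab hxy (hm _ _ h1) (hm _ _ h2) (hm _ _ h3)
    · exact hG.noncross (Adj.symm hxy) (Adj.symm hab) (hm _ _ h3) (hm _ _ h2) (hm _ _ h1)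

theorem deg_comap (G : SimpleGraph ℤ) (e : ℤ ≃ ℤ) (x : ℤ) : deg (G.comap e) x = deg G (e x) := by
  rw [deg, deg, ← Nat.card_coe_set_eq, ← Nat.card_coe_set_eq,
    Nat.card_congr ((Iso.comap e G).mapNeighborSet x)]
  rfl

/-! ### Counting -/

/-- The non-crossing trees on `[l, h]` in which the vertex `p` has degree `r` and all the other
vertices have degree at most `k + 1`. -/
def boundedTrees (k : ℕ) (l h p : ℤ) (r : ℕ) : Set (SimpleGraph ℤ) :=
  {G | IsIntervalTree l h G ∧ deg G p = r ∧ ∀ x, x ≠ p → deg G x ≤ k + 1}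

theorem finite_boundedTrees (k : ℕ) (l h p : ℤ) (r : ℕ) : (boundedTrees k l h p r).Finite :=
  (finite_livesOn l h).subset (fun _ hG => hG.1.mem)

/-- Applied to a shift or a reflection in both directions, this inequality gives equality of the
counts. -/
theorem ncard_boundedTrees_le {k : ℕ} {l h p l' h' p' : ℤ} {r : ℕ}
    (e : ℤ ≃ ℤ) (he : ∀ x, (l' ≤ x ∧ x ≤ h') ↔ (l ≤ e x ∧ e x ≤ h)) (hl : h' - l' = h - l)
    (hm : (∀ x y, x < y → e x < e y) ∨ (∀ x y, x < y → e y < e x)) (hp : e p' = p) :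
    (boundedTrees k l h p r).ncard ≤ (boundedTrees k l' h' p' r).ncard := by
  refine Set.ncard_le_ncard_of_injOn (fun G => G.comap e) ?_ ?_ (finite_boundedTrees _ _ _ _ _)
  · rintro G ⟨h1, h2, h3⟩
    refine ⟨h1.comap e he hl hm, ?_, fun x hx => ?_⟩
    · rw [deg_comap, hp, h2]
    · rw [deg_comap]
      exact h3 _ (fun h => hx (e.injective (h.trans hp.symm)))
  · exact (Equiv.simpleGraph e).symm.injective.injOn

/-- The number of non-crossing trees with `m` edges in which the first vertex has degree `r` and
all the other vertices have degree at most `k + 1`. -/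
noncomputable def treeCount (k m r : ℕ) : ℕ := (boundedTrees k 0 m 0 r).ncard

theorem ncard_boundedTrees_left (k m r : ℕ) (l : ℤ) :
    (boundedTrees k l (l + m) l r).ncard = treeCount k m r := by
  apply le_antisymm
  · refine ncard_boundedTrees_le (Equiv.addRight l) ?_ ?_ ?_ ?_ <;> (simp; try grind)
  · refine ncard_boundedTrees_le (Equiv.addRight (-l)) ?_ ?_ ?_ ?_ <;> (simp; try grind)

theorem ncard_boundedTrees_right (k m r : ℕ) (l : ℤ) :
    (boundedTrees k l (l + m) (l + m) r).ncard = treeCount k m r := by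
  apply le_antisymm
  · refine ncard_boundedTrees_le (Equiv.subLeft (l + m)) ?_ ?_ ?_ ?_ <;> (simp; try grind)
  · refine ncard_boundedTrees_le (Equiv.subLeft (l + m)) ?_ ?_ ?_ ?_ <;> (simp; try grind)

end NonCrossing

/-! ### The recursion for the number of trees -/

namespace NonCrossing

open SimpleGraph

theorem join_mem_boundedTrees {k r s t : ℕ} (hst : s + t ≤ k) {l j v h : ℤ} (hj : l ≤ j)
    (hv : j < v) (hh : v ≤ h) {A B C : SimpleGraph ℤ} (hA : A ∈ boundedTrees k l j l r)
    (hB : B ∈ boundedTrees k (j + 1) v v s) (hC : C ∈ boundedTrees k v h v t) :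
    join l v A B C ∈ boundedTrees k l h l (r + 1) := by
  obtain ⟨tA, dA, eA⟩ := hA
  obtain ⟨tB, dB, eB⟩ := hB
  obtain ⟨tC, dC, eC⟩ := hC
  refine ⟨tA.join hj hv hh tB tC, ?_, fun x hx => ?_⟩
  · rw [deg_join_left hj hv tA.mem tB.mem tC.mem, dA]
  · rcases le_or_gt x j with h1 | h1
    · rw [deg_join_of_le hj hv tB.mem tC.mem hx h1]
      exact eA x hx
    rcases lt_trichotomy x v with h2 | rfl | h2
    · rw [deg_join_of_lt_of_lt hj hv tA.mem tC.mem h1 h2]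
      exact eB x h2.ne
    · rw [deg_join_joint hj hv tA.mem tB.mem tC.mem]
      omega
    · rw [deg_join_of_gt hj hv tA.mem tB.mem h2]
      exact eC x h2.ne'

theorem exists_join_of_mem_boundedTrees {k r : ℕ} {l h : ℤ} (hlh : l < h) {G : SimpleGraph ℤ}
    (hG : G ∈ boundedTrees k l h l (r + 1)) :
    ∃ j v A B C s t, l ≤ j ∧ j < v ∧ v ≤ h ∧ s + t ≤ k ∧ A ∈ boundedTrees k l j l r ∧
      B ∈ boundedTrees k (j + 1) v v s ∧ C ∈ boundedTrees k v h v t ∧ join l v A B C = G := by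
  obtain ⟨tG, dG, eG⟩ := hG
  obtain ⟨j, v, A, B, C, hj, hv, hh, tA, tB, tC, rfl⟩ := tG.exists_join hlh
  have hA := tA.mem
  have hB := tB.mem
  have hC := tC.mem
  rw [deg_join_left hj hv hA hB hC] at dG
  have e := eG v (by omega)
  rw [deg_join_joint hj hv hA hB hC] at e
  refine ⟨j, v, A, B, C, deg B v, deg C v, hj, hv, hh, by omega, ⟨tA, by omega, ?_⟩,
    ⟨tB, rfl, ?_⟩, ⟨tC, rfl, ?_⟩, rfl⟩
  · intro x hx
    rcases le_or_gt x j with h1 | h1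
    · rw [← deg_join_of_le hj hv hB hC hx h1]
      exact eG x hx
    · rw [hA.deg_eq_zero (by omega)]; omega
  · intro x hx
    by_cases h1 : j < x ∧ x < v
    · rw [← deg_join_of_lt_of_lt hj hv hA hC h1.1 h1.2]
      exact eG x (by omega)
    · rw [hB.deg_eq_zero (by omega)]; omega
  · intro x hx
    rcases lt_or_gt_of_ne hx with h1 | h1
    · rw [hC.deg_eq_zero (by omega)]; omega
    · rw [← deg_join_of_gt hj hv hA hB h1]
      exact eG x (by omega)

open Finset in
-- The decomposition at the largest neighbour `v` of the root. The numbers `p.1`, `q.1`, `q.2` are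
-- the edge counts of the three pieces, and the joining edge is the extra one. The outdegree `d` of
-- `v` splits into `st.1` children on its left and `st.2` on its right.
theorem treeCount_succ_succ (k m r : ℕ) :
    treeCount k (m + 1) (r + 1) =
      ∑ p ∈ antidiagonal m, ∑ q ∈ antidiagonal p.2, ∑ d ∈ range (k + 1),
        ∑ st ∈ antidiagonal d,
          treeCount k p.1 r * treeCount k q.1 st.1 * treeCount k q.2 st.2 := by
  classical
  let T : ℤ → ℤ → ℤ → ℕ → Finset (SimpleGraph ℤ) := fun l h p r =>
    (finite_boundedTrees k l h p r).toFinset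
  have hT : ∀ {l h p r G}, G ∈ T l h p r ↔ G ∈ boundedTrees k l h p r := by
    intro l h p r G; simp [T]
  have cT : ∀ l h p r, (T l h p r).card = (boundedTrees k l h p r).ncard := by
    intro l h p r
    rw [Set.ncard_eq_toFinset_card _ (finite_boundedTrees k l h p r)]
  let I : Finset ((Σ _ : ℕ × ℕ, ℕ × ℕ) × (Σ _ : ℕ, ℕ × ℕ)) :=
    ((antidiagonal m).sigma (fun p => antidiagonal p.2)) ×ˢ
      ((range (k + 1)).sigma (fun d => antidiagonal d))
  have hI : ∀ {a a' b c d s t : ℕ}, ((⟨(a, a'), (b, c)⟩, ⟨d, (s, t)⟩) :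
      (Σ _ : ℕ × ℕ, ℕ × ℕ) × (Σ _ : ℕ, ℕ × ℕ)) ∈ I ↔
      (a + a' = m ∧ b + c = a') ∧ d < k + 1 ∧ s + t = d := by
    intros; simp [I]
  let S : (Σ _ : ℕ × ℕ, ℕ × ℕ) × (Σ _ : ℕ, ℕ × ℕ) →
      Finset (SimpleGraph ℤ × SimpleGraph ℤ × SimpleGraph ℤ) := fun i =>
    T 0 i.1.1.1 0 r ×ˢ T (i.1.1.1 + 1) (i.1.1.1 + 1 + i.1.2.1) (i.1.1.1 + 1 + i.1.2.1) i.2.2.1 ×ˢ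
      T (i.1.1.1 + 1 + i.1.2.1) (i.1.1.1 + 1 + i.1.2.1 + i.1.2.2) (i.1.1.1 + 1 + i.1.2.1) i.2.2.2
  have cS : ∀ i, (S i).card =
      treeCount k i.1.1.1 r * treeCount k i.1.2.1 i.2.2.1 * treeCount k i.1.2.2 i.2.2.2 := by
    intro i
    simp only [S, card_product, cT, ncard_boundedTrees_left, ncard_boundedTrees_right]
    simp only [treeCount, mul_assoc]
  have main : (T 0 (m + 1 : ℕ) 0 (r + 1)).card = (I.sigma S).card := by
    symm
    refine card_bij (fun x _ => join 0 (x.1.1.1.1 + 1 + x.1.1.2.1) x.2.1 x.2.2.1 x.2.2.2) ?_ ?_ ?_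
    · rintro ⟨⟨⟨⟨a, a'⟩, ⟨b, c⟩⟩, ⟨d, ⟨s, t⟩⟩⟩, A, B, C⟩ h
      simp only [mem_sigma, hI, S, mem_product, hT] at h
      obtain ⟨⟨⟨rfl, rfl⟩, hd, rfl⟩, hA, hB, hC⟩ := h
      rw [hT]
      dsimp only
      have e : ((a + (b + c) + 1 : ℕ) : ℤ) = a + 1 + b + c := by push_cast; ring
      rw [e]
      exact join_mem_boundedTrees (j := a) (by omega) (by omega) (by omega) (by omega) hA hB hC
    · rintro ⟨⟨⟨⟨a, a'⟩, ⟨b, c⟩⟩, ⟨d, ⟨s, t⟩⟩⟩, A, B, C⟩ h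
        ⟨⟨⟨⟨a₂, a₂'⟩, ⟨b₂, c₂⟩⟩, ⟨d₂, ⟨s₂, t₂⟩⟩⟩, A₂, B₂, C₂⟩ h₂ heq
      simp only [mem_sigma, hI, S, mem_product, hT] at h h₂
      obtain ⟨⟨⟨h1, h2⟩, hd, hst⟩, hA, hB, hC⟩ := h
      obtain ⟨⟨⟨h1₂, h2₂⟩, hd₂, hst₂⟩, hA₂, hB₂, hC₂⟩ := h₂
      have e : (a : ℤ) + 1 + b + c = m + 1 := by omega
      have e₂ : (a₂ : ℤ) + 1 + b₂ + c₂ = m + 1 := by omega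
      rw [e] at hC
      rw [e₂] at hC₂
      obtain ⟨f1, f2, rfl, rfl, rfl⟩ := join_injective (by omega) (by omega) hA.1 hB.1 hC.1
        (by omega) (by omega) hA₂.1 hB₂.1 hC₂.1 heq
      obtain rfl : a = a₂ := by omega
      obtain rfl : b = b₂ := by omega
      obtain rfl : s = s₂ := hB.2.1.symm.trans hB₂.2.1
      obtain rfl : t = t₂ := hC.2.1.symm.trans hC₂.2.1
      obtain rfl : d = d₂ := by omega
      obtain rfl : a' = a₂' := by omega
      obtain rfl : c = c₂ := by omega
      rfl
    · intro G hG
      rw [hT] at hG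
      obtain ⟨j, v, A, B, C, s, t, hj, hv, hh, hst, hA, hB, hC, rfl⟩ :=
        exists_join_of_mem_boundedTrees (by omega) hG
      obtain ⟨a, rfl⟩ := Int.eq_ofNat_of_zero_le hj
      obtain ⟨b, hb⟩ := Int.eq_ofNat_of_zero_le (show 0 ≤ v - (a + 1) by omega)
      obtain rfl : v = a + 1 + b := by omega
      obtain ⟨c, hc⟩ := Int.eq_ofNat_of_zero_le (show 0 ≤ (m + 1 : ℕ) - (a + 1 + b : ℤ) by omega)
      refine ⟨⟨(⟨(a, b + c), (b, c)⟩, ⟨s + t, (s, t)⟩), A, B, C⟩, ?_, rfl⟩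
      simp only [mem_sigma, hI, S, mem_product, hT]
      have e : (a + 1 + b + c : ℤ) = (m + 1 : ℕ) := by omega
      rw [e]
      exact ⟨⟨⟨by omega, trivial⟩, by omega, trivial⟩, hA, hB, hC⟩
  rw [treeCount, ← cT, main, card_sigma, sum_product]
  simp only [cS]
  rw [sum_sigma]
  refine sum_congr rfl fun p _ => sum_congr rfl fun q _ => ?_
  rw [sum_sigma]

theorem treeCount_zero_zero (k : ℕ) : treeCount k 0 0 = 1 := by
  rw [treeCount, Set.ncard_eq_one]
  refine ⟨⊥, Set.eq_singleton_iff_unique_mem.2 ⟨⟨⟨?_, ?_, ?_, ?_⟩, ?_, ?_⟩, ?_⟩⟩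
  · intro x y h; exact absurd h (by simp)
  · intro x y h1 h2 h3 h4
    obtain rfl : x = y := by push_cast at h2 h4; omega
    exact Reachable.refl _
  · simp
  · intro a b x y h; exact absurd h (by simp)
  · simp [deg, neighborSet]
  · intro x _; simp [deg, neighborSet]
  · rintro G ⟨hG, -⟩
    ext x y
    simp only [bot_adj, iff_false]
    intro h
    have h1 := hG.mem h
    have h2 := hG.mem h.symm
    exact h.ne (by push_cast at h1 h2; omega)

theorem treeCount_zero_succ (k r : ℕ) : treeCount k 0 (r + 1) = 0 := by
  rw [treeCount, Set.ncard_eq_zero (finite_boundedTrees _ _ _ _ _)]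
  refine Set.eq_empty_of_forall_notMem ?_
  rintro G ⟨hG, h1, -⟩
  have : G.neighborSet 0 = ∅ := by
    refine Set.eq_empty_of_forall_notMem fun y hy => ?_
    have := hG.mem (Adj.symm hy)
    exact Adj.ne hy (by push_cast at this; omega)
  rw [deg, this, Set.ncard_empty] at h1
  omega

theorem treeCount_succ_zero (k m : ℕ) : treeCount k (m + 1) 0 = 0 := by
  rw [treeCount, Set.ncard_eq_zero (finite_boundedTrees _ _ _ _ _)]
  refine Set.eq_empty_of_forall_notMem ?_
  rintro G ⟨hG, h1, -⟩
  obtain ⟨x, y, hx, hy, hxy⟩ := hG.exists_crossing_edge le_rfl (by omega)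
  obtain rfl : x = 0 := by have := hG.mem hxy; omega
  rw [deg, Set.ncard_eq_zero (hG.mem.finite_neighborSet 0)] at h1
  have : y ∈ G.neighborSet 0 := hxy
  rw [h1] at this
  exact this

end NonCrossing

/-! ### Generating functions and Lagrange inversion -/

namespace NonCrossing

open Finset

theorem treeCount_eq_zero_of_lt (k : ℕ) {m r : ℕ} (h : m < r) : treeCount k m r = 0 := by
  induction m using Nat.strong_induction_on generalizing r with
  | _ m ih =>
    obtain ⟨r, rfl⟩ : ∃ r', r = r' + 1 := ⟨r - 1, by omega⟩
    cases m with
    | zero => exact treeCount_zero_succ k r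
    | succ m =>
      rw [treeCount_succ_succ]
      refine sum_eq_zero fun p hp => sum_eq_zero fun q _ => sum_eq_zero fun d _ =>
        sum_eq_zero fun st _ => ?_
      rw [HasAntidiagonal.mem_antidiagonal] at hp
      rw [ih p.1 (by omega) (by omega)]
      simp

/-- The generating function of the non-crossing trees whose first vertex has degree `r`. -/
noncomputable def treeSeries (k r : ℕ) : PowerSeries ℕ := PowerSeries.mk fun m => treeCount k m r

theorem treeSeries_zero (k : ℕ) : treeSeries k 0 = 1 := by
  ext m
  cases m with
  | zero => simp [treeSeries, treeCount_zero_zero]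
  | succ m => simp [treeSeries, treeCount_succ_zero, PowerSeries.coeff_one]

theorem treeSeries_succ (k r : ℕ) : treeSeries k (r + 1) = PowerSeries.X * (treeSeries k r *
    ∑ d ∈ range (k + 1), ∑ st ∈ antidiagonal d, treeSeries k st.1 * treeSeries k st.2) := by
  ext m
  cases m with
  | zero => simp [treeSeries, treeCount_zero_succ]
  | succ m =>
    rw [PowerSeries.coeff_succ_X_mul, treeSeries, PowerSeries.coeff_mk, treeCount_succ_succ,
      PowerSeries.coeff_mul]
    refine sum_congr rfl fun p _ => ?_
    simp only [map_sum, PowerSeries.coeff_mul, treeSeries, PowerSeries.coeff_mk, mul_sum]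
    rw [sum_comm]
    refine sum_congr rfl fun d _ => ?_
    rw [sum_comm]
    simp only [mul_assoc]

/-- The Łukasiewicz recursion: the number of left children of a child of the root is any number
between `0` and its number `d` of children. -/
theorem treeCount_succ_succ_eq_sum (k m r : ℕ) :
    treeCount k (m + 1) (r + 1) = ∑ d ∈ range (k + 1), (d + 1) * treeCount k m (r + d) := by
  set β := ∑ d ∈ range (k + 1), ∑ st ∈ antidiagonal d, treeSeries k st.1 * treeSeries k st.2
    with hβ
  -- The factor `β` contributed by one child of the root does not depend on `r`, so `r` children
  -- contribute an `r`-th power.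
  have hpow : ∀ r, treeSeries k r = (PowerSeries.X * β) ^ r := by
    intro r
    induction r with
    | zero => rw [treeSeries_zero, pow_zero]
    | succ r ih => rw [treeSeries_succ, ← hβ, ih, pow_succ]; ring
  -- The product for `(s, t)` depends only on `s + t = d`, and there are `d + 1` such pairs: this is
  -- the source of the weight.
  have hβ' : β = ∑ d ∈ range (k + 1), (d + 1) • treeSeries k d := by
    rw [hβ]
    refine sum_congr rfl fun d _ => ?_
    rw [← Nat.card_antidiagonal d, ← sum_const]
    refine sum_congr rfl fun st hst => ?_
    rw [hpow, hpow, hpow, ← pow_add, HasAntidiagonal.mem_antidiagonal.1 hst]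
  have h : treeSeries k (r + 1) =
      PowerSeries.X * ∑ d ∈ range (k + 1), (d + 1) • treeSeries k (r + d) := by
    rw [treeSeries_succ, ← hβ, hβ', mul_sum]
    congr 1
    refine sum_congr rfl fun d _ => ?_
    rw [mul_smul_comm, hpow r, hpow d, hpow (r + d), pow_add]
  have h2 := congrArg (PowerSeries.coeff (m + 1)) h
  rw [PowerSeries.coeff_succ_X_mul] at h2
  simpa only [map_sum, map_nsmul, treeSeries, PowerSeries.coeff_mk, smul_eq_mul] using h2

/-- The weights `d + 1`, `d ≤ k`, of the outdegrees of the non-root vertices. -/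
noncomputable def stepPoly (k : ℕ) : Polynomial ℝ :=
  ∑ d ∈ range (k + 1), Polynomial.monomial d ((d : ℝ) + 1)

theorem coeff_stepPoly (k d : ℕ) : (stepPoly k).coeff d = if d ≤ k then (d : ℝ) + 1 else 0 := by
  simp only [stepPoly, Polynomial.finsetSum_coeff, Polynomial.coeff_monomial]
  simp

theorem coeff_X_mul_derivative (p : Polynomial ℝ) (N : ℕ) :
    (Polynomial.X * Polynomial.derivative p).coeff N = N * p.coeff N := by
  cases N with
  | zero => simp
  | succ N => rw [Polynomial.coeff_X_mul, Polynomial.coeff_derivative]; push_cast; ring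

/-- The Lagrange inversion formula for the number of trees. -/
theorem mul_treeCount (k m r N : ℕ) (h : N + r = m) :
    (m : ℝ) * treeCount k m r = r * ((stepPoly k) ^ m).coeff N := by
  induction m generalizing r N with
  | zero =>
    obtain rfl : r = 0 := by omega
    simp
  | succ m ih =>
    cases r with
    | zero => simp [treeCount_succ_zero]
    | succ r =>
      obtain rfl : m = N + r := by omega
      rw [treeCount_succ_succ_eq_sum]
      rcases Nat.eq_zero_or_pos (N + r) with h0 | hpos
      · obtain ⟨rfl, rfl⟩ : N = 0 ∧ r = 0 := by omega
        rw [sum_eq_single 0]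
        · simp [treeCount_zero_zero, coeff_stepPoly]
        · intro d _ hd
          rw [treeCount_eq_zero_of_lt k (by omega)]; simp
        · simp
      · have hm : ((N + r : ℕ) : ℝ) ≠ 0 := by positivity
        apply mul_left_cancel₀ hm
        set P := stepPoly k
        set Q := P ^ (N + r) with hQ
        have e1 : ((N + r : ℕ) : ℝ) * (∑ d ∈ range (k + 1), (d + 1) * treeCount k (N + r) (r + d) : ℕ) =
            ∑ x ∈ antidiagonal N, P.coeff x.1 * ((r + x.1 : ℕ) * Q.coeff x.2) := by
          rw [Nat.sum_antidiagonal_eq_sum_range_succ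
            (fun i j => P.coeff i * (((r + i : ℕ) : ℝ) * Q.coeff j))]
          push_cast
          rw [mul_sum]
          -- The summands vanish beyond `k` because of the truncation and beyond `N` because a tree
          -- with `N + r` edges has root degree at most `N + r`; hence either bound may be used for
          -- the sum.
          have hmax : ∀ s : ℕ → ℝ, (∀ d, k < d → s d = 0) → (∀ d, N < d → s d = 0) →
              ∑ d ∈ range (k + 1), s d = ∑ d ∈ range (N + 1), s d := by
            intro s h1 h2
            rcases le_total k N with h | h
            · refine sum_subset (range_subset_range.2 (by omega)) fun d _ hd => h1 d ?_
              simpa [Nat.lt_succ_iff] using hd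
            · refine (sum_subset (range_subset_range.2 (by omega)) fun d _ hd => h2 d ?_).symm
              simpa [Nat.lt_succ_iff] using hd
          have e2 : ∀ d, d ≤ N → ((N + r : ℕ) : ℝ) * treeCount k (N + r) (r + d) =
              (r + d : ℕ) * Q.coeff (N - d) := fun d hd => ih _ _ (by omega)
          push_cast at e2
          have e3 : ∑ d ∈ range (k + 1), ((N : ℝ) + r) * ((d + 1) * treeCount k (N + r) (r + d)) =
              ∑ d ∈ range (k + 1), P.coeff d * (((N : ℝ) + r) * treeCount k (N + r) (r + d)) := by
            refine sum_congr rfl fun d hd => ?_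
            rw [coeff_stepPoly, if_pos (by simpa [Nat.lt_succ_iff] using hd)]
            ring
          rw [e3, hmax]
          · refine sum_congr rfl fun d hd => ?_
            rw [e2 d (by simpa [Nat.lt_succ_iff] using hd)]
          · intro d hd
            rw [coeff_stepPoly, if_neg (by omega), zero_mul]
          · intro d hd
            rw [treeCount_eq_zero_of_lt k (by omega)]; simp
        -- The factor `r + x.1` splits the convolution in two: `r` gives a coefficient of `P ^ (N +
        -- r + 1)`, while `x.1` turns `P` into `X P'`. By the derivative of a power, `e5` reduces
        -- the second part to the same coefficient, and the identity `(N + r + 1) r + N = (N + r) (r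
        -- + 1)` closes the induction.
        have e4 : ∑ x ∈ antidiagonal N, P.coeff x.1 * ((r + x.1 : ℕ) * Q.coeff x.2) =
            r * (P ^ (N + r + 1)).coeff N +
              (Q * (Polynomial.X * Polynomial.derivative P)).coeff N := by
          rw [pow_succ', ← hQ, mul_comm Q, Polynomial.coeff_mul, Polynomial.coeff_mul, mul_sum,
            ← sum_add_distrib]
          refine sum_congr rfl fun x _ => ?_
          rw [coeff_X_mul_derivative]
          push_cast
          ring
        have e5 : ((N + r + 1 : ℕ) : ℝ) * (Q * (Polynomial.X * Polynomial.derivative P)).coeff N =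
            N * (P ^ (N + r + 1)).coeff N := by
          rw [← coeff_X_mul_derivative, Polynomial.derivative_pow_succ, ← Polynomial.coeff_C_mul]
          congr 1
          rw [← hQ]
          simp only [Nat.cast_add, Nat.cast_one, map_add, map_natCast, map_one]
          ring
        rw [mul_left_comm, e1, e4, mul_add, e5]
        push_cast
        ring

end NonCrossing

namespace NonCrossing

open Finset

/-! ### Coefficientwise estimates -/

/-- A power series with non-negative coefficients. -/
def CoeffNonneg (f : PowerSeries ℝ) : Prop := ∀ n, 0 ≤ PowerSeries.coeff n f

theorem CoeffNonneg.mul {f g : PowerSeries ℝ} (hf : CoeffNonneg f) (hg : CoeffNonneg g) :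
    CoeffNonneg (f * g) := fun n => by
  rw [PowerSeries.coeff_mul]
  exact sum_nonneg fun x _ => mul_nonneg (hf _) (hg _)

theorem CoeffNonneg.add {f g : PowerSeries ℝ} (hf : CoeffNonneg f) (hg : CoeffNonneg g) :
    CoeffNonneg (f + g) := fun n => by
  rw [map_add]
  exact add_nonneg (hf n) (hg n)

theorem coeffNonneg_zero : CoeffNonneg 0 := fun n => by simp

theorem coeffNonneg_one : CoeffNonneg 1 := fun n => by
  rw [PowerSeries.coeff_one]
  split_ifs <;> norm_num

theorem CoeffNonneg.pow {f : PowerSeries ℝ} (hf : CoeffNonneg f) (n : ℕ) :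
    CoeffNonneg (f ^ n) := by
  induction n with
  | zero => rw [pow_zero]; exact coeffNonneg_one
  | succ n ih => rw [pow_succ]; exact ih.mul hf

theorem CoeffNonneg.pow_sub_pow {f g : PowerSeries ℝ} (hf : CoeffNonneg f) (hg : CoeffNonneg g)
    (hfg : CoeffNonneg (f - g)) (n : ℕ) : CoeffNonneg (f ^ n - g ^ n) := by
  induction n with
  | zero => simpa using coeffNonneg_zero
  | succ n ih =>
    have : f ^ (n + 1) - g ^ (n + 1) = f * (f ^ n - g ^ n) + (f - g) * g ^ n := by ring
    rw [this]
    exact (hf.mul ih).add (hfg.mul (hg.pow n))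

/-- The difference of the powers is the sum of the `n + 1` products `f ^ i (f - g) g ^ (n - i)`, and
replacing `g` by `f` in them only increases coefficients. It is the union bound over the factor that
exceeds the truncation. -/
theorem CoeffNonneg.union_bound {f g : PowerSeries ℝ} (hf : CoeffNonneg f) (hg : CoeffNonneg g)
    (hfg : CoeffNonneg (f - g)) (n : ℕ) :
    CoeffNonneg (((n + 1 : ℕ) : PowerSeries ℝ) * ((f - g) * f ^ n) -
      (f ^ (n + 1) - g ^ (n + 1))) := by
  induction n with
  | zero => simpa using coeffNonneg_zero
  | succ n ih =>
    have : ((n + 1 + 1 : ℕ) : PowerSeries ℝ) * ((f - g) * f ^ (n + 1)) -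
        (f ^ (n + 1 + 1) - g ^ (n + 1 + 1)) =
        f * (((n + 1 : ℕ) : PowerSeries ℝ) * ((f - g) * f ^ n) - (f ^ (n + 1) - g ^ (n + 1))) +
        (f - g) * (f ^ (n + 1) - g ^ (n + 1)) := by
      push_cast
      ring
    rw [this]
    exact (hf.mul ih).add (hfg.mul (hf.pow_sub_pow hg hfg _))

/-- The generating function of all the outdegrees of non-root vertices. -/
noncomputable def fullSeries : PowerSeries ℝ := PowerSeries.mk fun d => (d : ℝ) + 1

theorem fullSeries_eq : fullSeries = (PowerSeries.mk 1 : PowerSeries ℝ) ^ 2 := by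
  rw [PowerSeries.mk_one_pow_eq_mk_choose_add]
  ext n
  simp [fullSeries, add_comm]

/-- The weighted number of outdegree sequences of length `m` and sum `N`. -/
noncomputable def seqCount (m N : ℕ) : ℝ := PowerSeries.coeff N (fullSeries ^ m)

theorem seqCount_succ (m N : ℕ) : seqCount (m + 1) N = (2 * m + 1 + N).choose N := by
  rw [seqCount, fullSeries_eq, ← pow_mul, show 2 * (m + 1) = 2 * m + 1 + 1 by ring,
    PowerSeries.mk_one_pow_eq_mk_choose_add, PowerSeries.coeff_mk, Nat.choose_symm_add]

theorem coeffNonneg_fullSeries : CoeffNonneg fullSeries := fun n => by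
  simp only [fullSeries, PowerSeries.coeff_mk]
  positivity

theorem coeffNonneg_stepPoly (k : ℕ) : CoeffNonneg (stepPoly k : PowerSeries ℝ) := fun n => by
  rw [Polynomial.coeff_coe, coeff_stepPoly]
  split_ifs <;> positivity

theorem coeff_fullSeries_sub (k d : ℕ) :
    PowerSeries.coeff d (fullSeries - (stepPoly k : PowerSeries ℝ)) =
      if k < d then (d : ℝ) + 1 else 0 := by
  rw [map_sub, Polynomial.coeff_coe, coeff_stepPoly, fullSeries, PowerSeries.coeff_mk]
  split_ifs <;> first | omega | ring

theorem coeffNonneg_fullSeries_sub (k : ℕ) :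
    CoeffNonneg (fullSeries - (stepPoly k : PowerSeries ℝ)) := fun n => by
  rw [coeff_fullSeries_sub]
  split_ifs <;> positivity

theorem seqCount_nonneg (m N : ℕ) : 0 ≤ seqCount m N := coeffNonneg_fullSeries.pow m N

theorem coeff_stepPoly_pow_nonneg (k m N : ℕ) : 0 ≤ ((stepPoly k) ^ m).coeff N := by
  have := (coeffNonneg_stepPoly k).pow m N
  rwa [← Polynomial.coe_pow, Polynomial.coeff_coe] at this

theorem coeff_stepPoly_pow_le (k m N : ℕ) : ((stepPoly k) ^ m).coeff N ≤ seqCount m N := by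
  have := coeffNonneg_fullSeries.pow_sub_pow (coeffNonneg_stepPoly k)
    (coeffNonneg_fullSeries_sub k) m N
  rw [← Polynomial.coe_pow, map_sub, Polynomial.coeff_coe] at this
  exact sub_nonneg.1 this

theorem seqCount_le_succ (m N : ℕ) : seqCount m N ≤ seqCount (m + 1) N := by
  have h : CoeffNonneg (fullSeries - 1) := fun n => by
    rw [map_sub, PowerSeries.coeff_one, fullSeries, PowerSeries.coeff_mk]
    split_ifs with h
    · simp [h]
    · simp; positivity
  have := (coeffNonneg_fullSeries.pow m).mul h N
  rw [mul_sub, mul_one, ← pow_succ, map_sub] at this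
  exact sub_nonneg.1 this

theorem seqCount_sub_le (k m N : ℕ) : seqCount (m + 1) N - ((stepPoly k) ^ (m + 1)).coeff N ≤
    (m + 1 : ℕ) * ∑ x ∈ antidiagonal N, (if k < x.1 then (x.1 : ℝ) + 1 else 0) *
      seqCount m x.2 := by
  have := coeffNonneg_fullSeries.union_bound (coeffNonneg_stepPoly k)
    (coeffNonneg_fullSeries_sub k) m N
  rw [← Polynomial.coe_pow, map_sub, map_sub, Polynomial.coeff_coe,
    ← map_natCast (PowerSeries.C (R := ℝ)), PowerSeries.coeff_C_mul, PowerSeries.coeff_mul] at this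
  simp only [coeff_fullSeries_sub] at this
  exact sub_nonneg.1 this

theorem coeff_stepPoly_pow_eq {k N : ℕ} (h : N ≤ k) (m : ℕ) :
    ((stepPoly k) ^ m).coeff N = seqCount m N := by
  cases m with
  | zero =>
    rw [seqCount, pow_zero, pow_zero, Polynomial.coeff_one, PowerSeries.coeff_one]
  | succ m =>
    refine le_antisymm (coeff_stepPoly_pow_le k _ N) ?_
    have := seqCount_sub_le k m N
    rw [sum_eq_zero] at this
    · linarith
    · intro x hx
      rw [HasAntidiagonal.mem_antidiagonal] at hx
      rw [if_neg (by omega), zero_mul]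

/-- The quotient of consecutive coefficients is `(2m + N) / (N + 1)`, which crosses 3 near `N = m -
1`. Thus the tilt by `3 ^ (-N)` puts the mode where the tree counts need it. -/
theorem three_mul_seqCount_le {m N : ℕ} (h : N + 1 < m) :
    3 * seqCount m N ≤ seqCount m (N + 1) := by
  obtain ⟨m, rfl⟩ : ∃ m', m = m' + 1 := ⟨m - 1, by omega⟩
  rw [seqCount_succ, seqCount_succ]
  have e := Nat.add_one_mul_choose_eq (2 * m + 1 + N) N
  have e' : ((2 * m + 1 + N + 1 : ℕ) : ℝ) * ((2 * m + 1 + N).choose N : ℝ) =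
      ((2 * m + 1 + N + 1).choose (N + 1) : ℝ) * ((N + 1 : ℕ) : ℝ) := by exact_mod_cast e
  rw [← add_assoc (2 * m + 1) N 1]
  have h1 : 3 * ((N + 1 : ℕ) : ℝ) ≤ ((2 * m + 1 + N + 1 : ℕ) : ℝ) := by
    have : 3 * (N + 1) ≤ 2 * m + 1 + N + 1 := by omega
    exact_mod_cast this
  have h2 : (0 : ℝ) < ((N + 1 : ℕ) : ℝ) := by positivity
  refine le_of_mul_le_mul_right ?_ h2
  rw [← e']
  nlinarith [Nat.cast_nonneg (α := ℝ) ((2 * m + 1 + N).choose N)]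

theorem seqCount_le_three_mul {m N : ℕ} (hm : 0 < m) (h : m ≤ N + 1) :
    seqCount m (N + 1) ≤ 3 * seqCount m N := by
  obtain ⟨m, rfl⟩ : ∃ m', m = m' + 1 := ⟨m - 1, by omega⟩
  rw [seqCount_succ, seqCount_succ]
  have e := Nat.add_one_mul_choose_eq (2 * m + 1 + N) N
  have e' : ((2 * m + 1 + N + 1 : ℕ) : ℝ) * ((2 * m + 1 + N).choose N : ℝ) =
      ((2 * m + 1 + N + 1).choose (N + 1) : ℝ) * ((N + 1 : ℕ) : ℝ) := by exact_mod_cast e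
  rw [← add_assoc (2 * m + 1) N 1]
  have h1 : ((2 * m + 1 + N + 1 : ℕ) : ℝ) ≤ 3 * ((N + 1 : ℕ) : ℝ) := by
    have : 2 * m + 1 + N + 1 ≤ 3 * (N + 1) := by omega
    exact_mod_cast this
  have h2 : (0 : ℝ) < ((N + 1 : ℕ) : ℝ) := by positivity
  refine le_of_mul_le_mul_right ?_ h2
  rw [← e']
  nlinarith [Nat.cast_nonneg (α := ℝ) ((2 * m + 1 + N).choose N)]

theorem pow_mul_seqCount_le {m N : ℕ} (d : ℕ) (h : N + d < m) :
    3 ^ d * seqCount m N ≤ seqCount m (N + d) := by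
  induction d with
  | zero => simp
  | succ d ih =>
    have h1 := three_mul_seqCount_le (m := m) (N := N + d) (by omega)
    have h2 := ih (by omega)
    rw [← add_assoc, pow_succ]
    linarith

/-- The mode of the tilted distribution is at `h - 1`. -/
theorem seqCount_le_mode (h t : ℕ) :
    seqCount (h + 1) t ≤ 3 ^ t * (seqCount (h + 1) h / 3 ^ h) := by
  rcases le_total t h with hth | hth
  · obtain ⟨d, rfl⟩ := Nat.exists_eq_add_of_le hth
    have := pow_mul_seqCount_le (m := t + d + 1) (N := t) d (by omega)
    rw [pow_add]
    have h3 : (0 : ℝ) < 3 ^ d := by positivity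
    have h4 : (0 : ℝ) < 3 ^ t := by positivity
    rw [← mul_div_assoc, mul_div_mul_left _ _ h4.ne', le_div_iff₀ h3]
    linarith
  · obtain ⟨d, rfl⟩ := Nat.exists_eq_add_of_le hth
    clear hth
    induction d with
    | zero => rw [add_zero]; exact le_of_eq (by field_simp)
    | succ d ih =>
      have h1 := seqCount_le_three_mul (m := h + 1) (N := h + d) (by omega) (by omega)
      rw [← add_assoc, pow_succ]
      linarith

/-- The central term of the tilted distribution, up to the normalisation `(27 / 4) ^ i`. -/
theorem central_seqCount_mono (i : ℕ) :
    (i + 1 : ℝ) * (seqCount (i + 1) i * (4 / 27) ^ i) ≤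
      (i + 1 + 1 : ℝ) * (seqCount (i + 2) (i + 1) * (4 / 27) ^ (i + 1)) := by
  -- The central binomial `(3i + 1).choose i` grows like `(27/4) ^ i / √i`; the factor `i + 1`
  -- outweighs the square root, so that monotonicity can take the place of Stirling's formula.
  rw [seqCount_succ, seqCount_succ]
  have e1 := Nat.add_one_mul_choose_eq (3 * i + 3) i
  have e2 := Nat.choose_mul_succ_eq (3 * i + 1) i
  have e3 := Nat.choose_mul_succ_eq (3 * i + 2) i
  rw [show 3 * i + 1 + 1 - i = 2 * i + 2 by omega] at e2
  rw [show 3 * i + 2 + 1 - i = 2 * i + 3 by omega] at e3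
  rw [show 2 * i + 1 + i = 3 * i + 1 by ring, show 2 * (i + 1) + 1 + (i + 1) = 3 * i + 3 + 1 by ring]
  set u := ((3 * i + 1).choose i : ℝ) with hu
  have f1 : ((3 * i + 3 + 1 : ℕ) : ℝ) * ((3 * i + 3).choose i : ℝ) =
    ((3 * i + 3 + 1).choose (i + 1) : ℝ) * ((i + 1 : ℕ) : ℝ) := by exact_mod_cast e1
  have f2 : u * ((3 * i + 1 + 1 : ℕ) : ℝ) =
    ((3 * i + 1 + 1).choose i : ℝ) * ((2 * i + 2 : ℕ) : ℝ) := by rw [hu]; exact_mod_cast e2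
  have f3 : ((3 * i + 2).choose i : ℝ) * ((3 * i + 2 + 1 : ℕ) : ℝ) =
    ((3 * i + 2 + 1).choose i : ℝ) * ((2 * i + 3 : ℕ) : ℝ) := by exact_mod_cast e3
  push_cast at f1 f2 f3
  have hi : (0 : ℝ) ≤ i := Nat.cast_nonneg i
  have hu0 : 0 ≤ u := Nat.cast_nonneg _
  have g2 : ((3 * i + 1 + 1).choose i : ℝ) = u * (3 * i + 2) / (2 * i + 2) := by
    rw [eq_div_iff (by positivity)]; linarith
  have g3 : ((3 * i + 2 + 1).choose i : ℝ) =
      u * (3 * i + 2) / (2 * i + 2) * (3 * i + 3) / (2 * i + 3) := by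
    rw [← g2, eq_div_iff (by positivity)]; linarith
  have g1 : ((3 * i + 3 + 1).choose (i + 1) : ℝ) =
      u * (3 * i + 2) / (2 * i + 2) * (3 * i + 3) / (2 * i + 3) * (3 * i + 4) / (i + 1) := by
    rw [← g3, eq_div_iff (by positivity)]; linarith
  rw [g1, pow_succ]
  have key : (i + 1 : ℝ) * u ≤ (i + 1 + 1) *
      (u * (3 * i + 2) / (2 * i + 2) * (3 * i + 3) / (2 * i + 3) * (3 * i + 4) / (i + 1)) *
        (4 / 27) := by
    have : (i + 1 + 1 : ℝ) *
      (u * (3 * i + 2) / (2 * i + 2) * (3 * i + 3) / (2 * i + 3) * (3 * i + 4) / (i + 1)) *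
        (4 / 27) = u * (((i + 2) * (3 * i + 2) * (3 * i + 4) * 2) / (9 * (i + 1) * (2 * i + 3))) := by
      field_simp
      ring
    rw [this, mul_comm]
    refine mul_le_mul_of_nonneg_left ?_ hu0
    rw [le_div_iff₀ (by positivity)]
    nlinarith [mul_nonneg hi hi]
  have hp : (0 : ℝ) ≤ (4 / 27) ^ i := by positivity
  nlinarith [mul_le_mul_of_nonneg_right key hp]

theorem central_seqCount_le {i j : ℕ} (hij : i ≤ j) :
    (i + 1 : ℝ) * (seqCount (i + 1) i * (4 / 27) ^ i) ≤
      (j + 1 : ℝ) * (seqCount (j + 1) j * (4 / 27) ^ j) := by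
  have := monotone_nat_of_le_succ
    (f := fun i : ℕ => (i + 1 : ℝ) * (seqCount (i + 1) i * (4 / 27) ^ i))
    (fun i => by have := central_seqCount_mono i; push_cast; exact this)
  exact this hij

end NonCrossing

/-! ### Bounds for the number of trees with bounded outdegrees -/

namespace NonCrossing

open Finset

/-- The number of non-crossing trees with `m` edges whose outdegrees are at most `k`. -/
noncomputable def boundedCount (k m : ℕ) : ℕ := ∑ r ∈ range (k + 1), treeCount k m r

theorem boundedCount_eq_sum (k m : ℕ) :
    boundedCount k m = ∑ r ∈ range (m + 1), if r ≤ k then treeCount k m r else 0 := by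
  rw [← sum_filter, boundedCount]
  symm
  apply sum_subset
  · intro r
    simp only [mem_filter, mem_range]
    omega
  · intro r hr hr'
    apply treeCount_eq_zero_of_lt
    simp only [mem_filter, mem_range] at hr hr'
    omega

theorem mul_treeCount_self {m r : ℕ} (h : r ≤ m) :
    (m : ℝ) * treeCount m m r = r * seqCount m (m - r) := by
  rw [mul_treeCount m m r (m - r) (by omega), coeff_stepPoly_pow_eq (by omega)]

theorem mul_treeCount_one {m : ℕ} (h : 0 < m) :
    (m : ℝ) * treeCount m m 1 = seqCount m (m - 1) := by
  rw [mul_treeCount_self h]; simp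

/-- The tail of the distribution of the outdegrees. -/
theorem sum_tail_le (k M : ℕ) :
    ∑ d ∈ range (M + 1), (if k < d then ((d : ℝ) + 1) / 3 ^ d else 0) ≤
      (2 * k + 5) / (4 * 3 ^ k) := by
  rcases lt_or_ge M k with h | h
  · rw [sum_eq_zero]
    · positivity
    · intro d hd
      rw [if_neg (by rw [mem_range] at hd; omega)]
  · obtain ⟨j, rfl⟩ := Nat.exists_eq_add_of_le h
    clear h
    -- The full tail beyond `k` is `(2k + 5) / (4 · 3 ^ k)`; the finite sum is the difference of two
    -- such tails.
    have : ∑ d ∈ range (k + j + 1), (if k < d then ((d : ℝ) + 1) / 3 ^ d else 0) =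
        (2 * k + 5) / (4 * 3 ^ k) - (2 * (k + j) + 5) / (4 * 3 ^ (k + j)) := by
      induction j with
      | zero =>
        rw [sum_eq_zero]
        · simp
        · intro d hd
          rw [if_neg (by rw [mem_range] at hd; omega)]
      | succ j ih =>
        rw [← add_assoc, sum_range_succ, ih, if_pos (by omega), pow_succ]
        push_cast
        field_simp
        ring
    rw [this]
    have : (0 : ℝ) ≤ (2 * (k + j) + 5) / (4 * 3 ^ (k + j)) := by positivity
    linarith

theorem eval_stepPoly (k : ℕ) :
    (stepPoly k).eval (1 / 3) = 9 / 4 * (1 - (2 * k + 5) / (9 * 3 ^ k)) := by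
  rw [stepPoly, Polynomial.eval_finsetSum]
  simp only [Polynomial.eval_monomial]
  induction k with
  | zero => norm_num
  | succ k ih =>
    rw [sum_range_succ, ih, pow_succ, one_div, inv_pow, pow_succ]
    push_cast
    field_simp
    ring

/-- In the union bound a factor of degree `d` leaves the coefficient at `N - d`. Below the mode this
is at most `3 ^ (-d)` times the one at `N`, so only the tilted tail of one factor remains. -/
theorem seqCount_sub_le_tail {m N : ℕ} (k : ℕ) (hN : N < m) :
    seqCount m N - ((stepPoly k) ^ m).coeff N ≤
      m * ((2 * k + 5) / (4 * 3 ^ k)) * seqCount m N := by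
  obtain ⟨m, rfl⟩ : ∃ m', m = m' + 1 := ⟨m - 1, by omega⟩
  refine (seqCount_sub_le k m N).trans ?_
  rw [mul_assoc]
  refine mul_le_mul_of_nonneg_left ?_ (Nat.cast_nonneg _)
  refine le_trans ?_ (mul_le_mul_of_nonneg_right (sum_tail_le k N) (seqCount_nonneg _ _))
  rw [Finset.Nat.sum_antidiagonal_eq_sum_range_succ
    (fun i j => (if k < i then (i : ℝ) + 1 else 0) * seqCount m j), sum_mul]
  refine sum_le_sum fun d hd => ?_
  rw [mem_range] at hd
  split_ifs
  · have h1 := pow_mul_seqCount_le (m := m + 1) (N := N - d) d (by omega)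
    rw [Nat.sub_add_cancel (by omega)] at h1
    have h2 := seqCount_le_succ m (N - d)
    have h3 : (0 : ℝ) < 3 ^ d := by positivity
    rw [div_mul_eq_mul_div, le_div_iff₀ h3, mul_assoc]
    refine mul_le_mul_of_nonneg_left ?_ (by positivity)
    calc seqCount m (N - d) * 3 ^ d ≤ seqCount (m + 1) (N - d) * 3 ^ d :=
          mul_le_mul_of_nonneg_right h2 h3.le
      _ ≤ _ := by linarith
  · simp

/-- The first moment bound. -/
theorem boundedCount_upper (k : ℕ) {m : ℕ} (hm : 0 < m) :
    (boundedCount m m : ℝ) - boundedCount k m ≤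
      (m + 3) * ((2 * k + 5) / (4 * 3 ^ k)) * boundedCount m m := by
  set τ : ℝ := (2 * k + 5) / (4 * 3 ^ k) with hτ
  have hτ0 : 0 ≤ τ := by positivity
  have hm' : (0 : ℝ) < m := by exact_mod_cast hm
  have e1 : (boundedCount m m : ℝ) = ∑ r ∈ range (m + 1), (treeCount m m r : ℝ) := by
    simp [boundedCount]
  have e2 : (boundedCount k m : ℝ) =
      ∑ r ∈ range (m + 1), if r ≤ k then (treeCount k m r : ℝ) else 0 := by
    rw [boundedCount_eq_sum]
    push_cast
    rfl
  -- The first part accounts for non-root vertices of outdegree above `k`, the second for such a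
  -- root. In the second the count with root degree `r` is compared with the one with root degree 1,
  -- which lies `r - 1` steps further up towards the mode; this is the origin of the factor 3.
  have term : ∀ r ∈ range (m + 1),
      (treeCount m m r : ℝ) - (if r ≤ k then (treeCount k m r : ℝ) else 0) ≤
        m * τ * treeCount m m r +
          3 * treeCount m m 1 * (if k < r then ((r : ℝ) + 1) / 3 ^ r else 0) := by
    intro r hr
    rw [mem_range, Nat.lt_succ_iff] at hr
    by_cases hrk : r ≤ k
    · rw [if_pos hrk, if_neg (by omega), mul_zero, add_zero]
      refine le_of_mul_le_mul_left ?_ hm'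
      have h1 := mul_treeCount_self hr
      have h2 := mul_treeCount k m r (m - r) (by omega)
      rw [mul_sub, h1, h2, ← mul_sub, mul_left_comm (m : ℝ), h1]
      rcases Nat.eq_zero_or_pos r with rfl | hr0
      · simp
      · have := seqCount_sub_le_tail (m := m) (N := m - r) k (by omega)
        have hr1 : (0 : ℝ) ≤ r := Nat.cast_nonneg r
        calc _ ≤ (r : ℝ) * (m * τ * seqCount m (m - r)) := mul_le_mul_of_nonneg_left this hr1
          _ = _ := by ring
    · rw [if_neg hrk, if_pos (by omega), sub_zero]
      have h0 : (0 : ℝ) ≤ m * τ * treeCount m m r := by positivity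
      refine le_trans ?_ (le_add_of_nonneg_left h0)
      refine le_of_mul_le_mul_left ?_ hm'
      have h1 := mul_treeCount_self hr
      have h2 := mul_treeCount_one hm
      have h3 := pow_mul_seqCount_le (m := m) (N := m - r) (r - 1) (by omega)
      rw [show m - r + (r - 1) = m - 1 by omega] at h3
      have h4 : (3 : ℝ) ^ r = 3 * 3 ^ (r - 1) := by
        rw [← pow_succ', Nat.sub_add_cancel (by omega)]
      have h5 : (0 : ℝ) < 3 ^ (r - 1) := by positivity
      have h6 : (m : ℝ) * (3 * treeCount m m 1 * (((r : ℝ) + 1) / 3 ^ r)) =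
          (r + 1) * seqCount m (m - 1) / 3 ^ (r - 1) := by
        rw [h4, ← h2]
        field_simp
      rw [h1, h6, le_div_iff₀ h5]
      have h7 := seqCount_nonneg m (m - r)
      have hr1 : (0 : ℝ) ≤ r := Nat.cast_nonneg r
      nlinarith [mul_nonneg h5.le h7]
  have one_le : (treeCount m m 1 : ℝ) ≤ boundedCount m m := by
    rw [e1]
    exact single_le_sum (f := fun r => (treeCount m m r : ℝ)) (fun _ _ => Nat.cast_nonneg _)
      (by simp; omega)
  calc (boundedCount m m : ℝ) - boundedCount k m
      = ∑ r ∈ range (m + 1),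
        ((treeCount m m r : ℝ) - (if r ≤ k then (treeCount k m r : ℝ) else 0)) := by
        rw [e1, e2, sum_sub_distrib]
    _ ≤ _ := sum_le_sum term
    _ = m * τ * boundedCount m m + 3 * treeCount m m 1 *
          ∑ r ∈ range (m + 1), (if k < r then ((r : ℝ) + 1) / 3 ^ r else 0) := by
        rw [sum_add_distrib, ← mul_sum, ← mul_sum, ← e1]
    _ ≤ m * τ * boundedCount m m + 3 * boundedCount m m * τ := by
        have := sum_tail_le k m
        gcongr
    _ = _ := by ring

theorem coeff_le_eval (p : Polynomial ℝ) (hp : ∀ n, 0 ≤ p.coeff n) (N : ℕ) :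
    ∑ s ∈ range (N + 1), p.coeff s * (1 / 3) ^ s ≤ p.eval (1 / 3) := by
  rw [Polynomial.eval_eq_sum_range' (n := max (N + 1) (p.natDegree + 1)) (by omega)]
  refine sum_le_sum_of_subset_of_nonneg (range_subset_range.2 (le_max_left _ _)) fun s _ _ => ?_
  exact mul_nonneg (hp s) (by positivity)

/-- The bound on the last `h + 1` factors by the mode depends on their degree only through a power
of 3. The degree of the first `a` factors is therefore no longer constrained, and summing over it
gives the evaluation at `1 / 3`. -/
theorem coeff_stepPoly_pow_le_tilt (k a h N : ℕ) :
    ((stepPoly k) ^ (a + (h + 1))).coeff N ≤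
      3 ^ N * (seqCount (h + 1) h / 3 ^ h) * ((stepPoly k).eval (1 / 3)) ^ a := by
  set U := seqCount (h + 1) h / 3 ^ h with hU
  have hU0 : 0 ≤ U := div_nonneg (seqCount_nonneg _ _) (by positivity)
  rw [pow_add, Polynomial.coeff_mul, Finset.Nat.sum_antidiagonal_eq_sum_range_succ
    (fun i j => ((stepPoly k) ^ a).coeff i * ((stepPoly k) ^ (h + 1)).coeff j),
    ← Polynomial.eval_pow]
  refine le_trans ?_ (mul_le_mul_of_nonneg_left
    (coeff_le_eval _ (coeff_stepPoly_pow_nonneg k a) N) (by positivity))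
  rw [mul_sum]
  refine sum_le_sum fun s hs => ?_
  rw [mem_range, Nat.lt_succ_iff] at hs
  have h1 := (coeff_stepPoly_pow_le k (h + 1) (N - s)).trans (seqCount_le_mode h (N - s))
  refine (mul_le_mul_of_nonneg_left h1 (coeff_stepPoly_pow_nonneg k a s)).trans (le_of_eq ?_)
  have : (3 : ℝ) ^ N = 3 ^ (N - s) * 3 ^ s := by rw [← pow_add, Nat.sub_add_cancel hs]
  have h3 : (3 : ℝ) ^ s * (1 / 3) ^ s = 1 := by rw [← mul_pow]; norm_num
  rw [this, ← hU]
  linear_combination (-(stepPoly k ^ a).coeff s * U * 3 ^ (N - s)) * h3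

/-- Half of the outdegrees are essentially independent. -/
theorem boundedCount_lower (k : ℕ) {m : ℕ} (hm : 0 < m) :
    (boundedCount k m : ℝ) ≤
      8 * (1 - (2 * k + 5) / (9 * 3 ^ k)) ^ (m / 2) * boundedCount m m := by
  obtain ⟨h, hh⟩ : ∃ h, m = m / 2 + (h + 1) := ⟨m - m / 2 - 1, by omega⟩
  set a := m / 2 with ha
  set q : ℝ := 1 - (2 * k + 5) / (9 * 3 ^ k) with hq
  have hm' : (0 : ℝ) < m := by exact_mod_cast hm
  have hq0 : 0 ≤ q := by
    have h1 : 0 ≤ (stepPoly k).eval (1 / 3) := by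
      refine le_trans ?_ (coeff_le_eval (stepPoly k) (fun n => ?_) 0)
      · simp [coeff_stepPoly]
      · rw [coeff_stepPoly]; split_ifs <;> positivity
    rw [eval_stepPoly, ← hq] at h1
    linarith
  set U := seqCount (h + 1) h / 3 ^ h with hU
  have hU0 : 0 ≤ U := div_nonneg (seqCount_nonneg _ _) (by positivity)
  refine le_of_mul_le_mul_left ?_ hm'
  -- The sum over the root degree costs `∑ (r + 1) / 3 ^ r ≤ 5 / 4` over `r ≥ 1`; root degree 0 is
  -- killed by the factor `r` of the inversion formula.
  have step1 : (m : ℝ) * boundedCount k m ≤ 3 ^ m * U * (9 / 4 * q) ^ a * (5 / 4) := by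
    rw [boundedCount_eq_sum]
    push_cast
    rw [mul_sum]
    have term : ∀ r ∈ range (m + 1), (m : ℝ) * (if r ≤ k then (treeCount k m r : ℝ) else 0) ≤
        3 ^ m * U * (9 / 4 * q) ^ a * (if 0 < r then ((r : ℝ) + 1) / 3 ^ r else 0) := by
      intro r hr
      rw [mem_range, Nat.lt_succ_iff] at hr
      have hX : 0 ≤ 3 ^ m * U * (9 / 4 * q) ^ a := by positivity
      have hle : (m : ℝ) * treeCount k m r ≤
          3 ^ m * U * (9 / 4 * q) ^ a * (if 0 < r then ((r : ℝ) + 1) / 3 ^ r else 0) := by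
        rw [mul_treeCount k m r (m - r) (by omega)]
        rcases Nat.eq_zero_or_pos r with rfl | hr0
        · simp
        · rw [if_pos hr0]
          have h1 := coeff_stepPoly_pow_le_tilt k a h (m - r)
          rw [← hh, eval_stepPoly, ← hU, ← hq] at h1
          have h2 : (3 : ℝ) ^ m = 3 ^ (m - r) * 3 ^ r := by
            rw [← pow_add, Nat.sub_add_cancel hr]
          have h3 : 3 ^ m * U * (9 / 4 * q) ^ a * (((r : ℝ) + 1) / 3 ^ r) =
              (r + 1) * (3 ^ (m - r) * U * (9 / 4 * q) ^ a) := by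
            rw [h2]
            field_simp
          rw [h3]
          have h4 := coeff_stepPoly_pow_nonneg k m (m - r)
          have hr1 : (0 : ℝ) ≤ r := Nat.cast_nonneg r
          nlinarith [mul_le_mul_of_nonneg_left h1 hr1]
      split_ifs with h1 h2 h2
      · simpa only [if_pos h2] using hle
      · simpa only [if_neg h2] using hle
      · rw [mul_zero]; positivity
      · simp
    refine (sum_le_sum term).trans ?_
    rw [← mul_sum]
    have h1 : ∑ r ∈ range (m + 1), (if 0 < r then ((r : ℝ) + 1) / 3 ^ r else 0) ≤ 5 / 4 := by
      have := sum_tail_le 0 m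
      norm_num at this ⊢
      exact this
    exact mul_le_mul_of_nonneg_left h1 (by positivity)
  -- Trees whose root has degree 1 already give a sufficient lower bound for the total number.
  have step2 : seqCount m (m - 1) ≤ m * boundedCount m m := by
    rw [← mul_treeCount_one hm]
    refine mul_le_mul_of_nonneg_left ?_ hm'.le
    rw [boundedCount]
    push_cast
    exact single_le_sum (f := fun r => (treeCount m m r : ℝ)) (fun _ _ => Nat.cast_nonneg _)
      (by simp; omega)
  -- Monotonicity of the weighted central terms loses only the ratio `m / (h + 1)`, which is at most
  -- 2 because `h + 1` is at least half of `m`.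
  have step3 : seqCount (h + 1) h * (4 / 27) ^ h ≤
      2 * (seqCount m (m - 1) * (4 / 27) ^ (a + h)) := by
    have h1 := central_seqCount_le (i := h) (j := a + h) (by omega)
    rw [show a + h + 1 = m by omega, show a + h = m - 1 by omega] at h1
    rw [show a + h = m - 1 by omega]
    have h2 : ((m - 1 : ℕ) + 1 : ℝ) ≤ 2 * (h + 1) := by
      have : m - 1 + 1 ≤ 2 * (h + 1) := by omega
      exact_mod_cast this
    have h3 : 0 ≤ seqCount m (m - 1) * (4 / 27) ^ (m - 1) :=
      mul_nonneg (seqCount_nonneg _ _) (by positivity)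
    have h4 : (0 : ℝ) < h + 1 := by positivity
    refine le_of_mul_le_mul_left ?_ h4
    nlinarith [mul_le_mul_of_nonneg_right h2 h3]
  have hS := seqCount_nonneg m (m - 1)
  set S := seqCount m (m - 1)
  have h27 : (4 / 27 : ℝ) ^ (a + h) = (4 / 27) ^ h * (4 / 27) ^ a := by rw [pow_add, mul_comm]
  have hp : (0 : ℝ) < (4 / 27) ^ h := by positivity
  have step4 : seqCount (h + 1) h ≤ 2 * (S * (4 / 27) ^ a) := by
    refine le_of_mul_le_mul_right ?_ hp
    rw [h27] at step3
    linarith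
  have step5 : 3 ^ m * U * (9 / 4 * q) ^ a * (5 / 4) =
      15 / 4 * q ^ a * ((27 / 4) ^ a * seqCount (h + 1) h) := by
    have h1 : (27 / 4 : ℝ) ^ a = 3 ^ a * (9 / 4) ^ a := by rw [← mul_pow]; norm_num
    have h2 : (3 : ℝ) ^ m = 3 ^ a * 3 ^ h * 3 := by
      rw [← pow_add, ← pow_succ, add_assoc, ← hh]
    rw [hU, h1, h2, mul_pow]
    field_simp
    ring
  have h5 : (27 / 4 : ℝ) ^ a * (4 / 27) ^ a = 1 := by rw [← mul_pow]; norm_num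
  calc (m : ℝ) * boundedCount k m ≤ _ := step1
    _ = 15 / 4 * q ^ a * ((27 / 4) ^ a * seqCount (h + 1) h) := step5
    _ ≤ 15 / 4 * q ^ a * ((27 / 4) ^ a * (2 * (S * (4 / 27) ^ a))) := by gcongr
    _ = 15 / 2 * q ^ a * S := by linear_combination (15 / 2 * q ^ a * S) * h5
    _ ≤ 8 * q ^ a * S := by gcongr; norm_num
    _ ≤ 8 * q ^ a * (m * boundedCount m m) := by gcongr
    _ = _ := by ring

end NonCrossing

namespace NonCrossing

open SimpleGraph

/-! ### Chords of the regular polygon -/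

/-- Twice the signed area of the triangle with vertices `p`, `q`, `z`. -/
def orient (p q z : ℂ) : ℝ := (q.re - p.re) * (z.im - p.im) - (q.im - p.im) * (z.re - p.re)

theorem orient_rotate (p q z : ℂ) : orient q z p = orient p q z := by
  simp only [orient]; ring

theorem orient_swap (p q z : ℂ) : orient p z q = -orient p q z := by
  simp only [orient]; ring

theorem orient_polygonVertex_pos {n : ℕ} {i j k : Fin n} (hij : i < j) (hjk : j < k) :
    0 < orient (polygonVertex n i) (polygonVertex n j) (polygonVertex n k) := by
  have hn : (0 : ℝ) < n := by exact_mod_cast (Nat.zero_le _).trans_lt i.2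
  have hform : ∀ k : Fin n, polygonVertex n k =
      Complex.exp (((2 * (Real.pi * ((k : ℕ) : ℝ) / n) : ℝ) : ℂ) * Complex.I) := by
    intro k
    unfold polygonVertex
    congr 1
    push_cast
    ring
  set θ : Fin n → ℝ := fun k => Real.pi * ((k : ℕ) : ℝ) / n with hθ
  have hre : ∀ k, (polygonVertex n k).re = Real.cos (2 * θ k) := fun k => by
    rw [hform, Complex.exp_ofReal_mul_I_re]
  have him : ∀ k, (polygonVertex n k).im = Real.sin (2 * θ k) := fun k => by
    rw [hform, Complex.exp_ofReal_mul_I_im]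
  have hlt : ∀ {a b : Fin n}, a < b → 0 < θ b - θ a := by
    intro a b hab
    have : ((a : ℕ) : ℝ) < ((b : ℕ) : ℝ) := by exact_mod_cast hab
    have h2 := Real.pi_pos
    simp only [hθ]
    rw [← sub_div, ← mul_sub]
    exact div_pos (mul_pos h2 (by linarith)) hn
  have hpi : ∀ a b : Fin n, θ b - θ a < Real.pi := by
    intro a b
    have h1 : ((b : ℕ) : ℝ) < n := by exact_mod_cast b.2
    have h2 := Real.pi_pos
    have h3 : (0 : ℝ) ≤ ((a : ℕ) : ℝ) := Nat.cast_nonneg _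
    simp only [hθ]
    rw [← sub_div, ← mul_sub, div_lt_iff₀ hn]
    exact mul_lt_mul_of_pos_left (by linarith) h2
  -- The angles `θ` are half of the polar angles, so that the area of an inscribed triangle is a
  -- product of sines of differences of `θ`, all of which lie in `(0, π)`.
  have key : orient (polygonVertex n i) (polygonVertex n j) (polygonVertex n k) =
      4 * Real.sin (θ j - θ i) * Real.sin (θ k - θ j) * Real.sin (θ k - θ i) := by
    simp only [orient, hre, him, Real.sin_sub, Real.sin_two_mul, Real.cos_two_mul']
    have h1 := Real.sin_sq_add_cos_sq (θ i)
    have h2 := Real.sin_sq_add_cos_sq (θ j)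
    have h3 := Real.sin_sq_add_cos_sq (θ k)
    set a := Real.sin (θ i)
    set b := Real.cos (θ i)
    set c := Real.sin (θ j)
    set d := Real.cos (θ j)
    set e := Real.sin (θ k)
    set f := Real.cos (θ k)
    linear_combination
      -((d ^ 2 - c ^ 2) * (2 * e * f) - (2 * c * d) * (f ^ 2 - e ^ 2)) * h1 -
      ((f ^ 2 - e ^ 2) * (2 * a * b) - (2 * e * f) * (b ^ 2 - a ^ 2)) * h2 -
      ((b ^ 2 - a ^ 2) * (2 * c * d) - (2 * a * b) * (d ^ 2 - c ^ 2)) * h3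
  rw [key]
  have s1 := Real.sin_pos_of_pos_of_lt_pi (hlt hij) (hpi i j)
  have s2 := Real.sin_pos_of_pos_of_lt_pi (hlt hjk) (hpi j k)
  have s3 := Real.sin_pos_of_pos_of_lt_pi (hlt (hij.trans hjk)) (hpi i k)
  positivity

theorem orient_combo (p q x y : ℂ) (s t : ℝ) (h : s + t = 1) :
    orient p q (s • x + t • y) = s * orient p q x + t * orient p q y := by
  obtain rfl : s = 1 - t := by linarith
  simp [orient]
  ring

theorem orient_of_mem_openSegment {p q z : ℂ} (hz : z ∈ openSegment ℝ p q) : orient p q z = 0 := by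
  obtain ⟨s, t, -, -, hst, rfl⟩ := hz
  rw [orient_combo p q p q s t hst]
  simp only [orient]
  ring

/-- Interlaced chords meet. -/
theorem not_disjoint_of_interlaced {n : ℕ} {a x b y : Fin n} (h1 : a < x) (h2 : x < b)
    (h3 : b < y) :
    ¬ Disjoint (openSegment ℝ (polygonVertex n a) (polygonVertex n b))
      (openSegment ℝ (polygonVertex n x) (polygonVertex n y)) := by
  rw [Set.not_disjoint_iff]
  have d1 := orient_polygonVertex_pos h2 h3
  have d2 := orient_polygonVertex_pos h1 (h2.trans h3)
  have d3 := orient_polygonVertex_pos (h1.trans h2) h3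
  have d4 := orient_polygonVertex_pos h1 h2
  set A := polygonVertex n a
  set B := polygonVertex n b
  set X := polygonVertex n x
  set Y := polygonVertex n y
  -- Both sides are twice the area of the quadrilateral `A X B Y`, cut along one diagonal or the
  -- other. The barycentric coordinates of the intersection point are quotients of these areas.
  have hsum : orient A B Y + orient A X B = orient X B Y + orient A X Y := by
    simp only [orient]; ring
  have hS : 0 < orient X B Y + orient A X Y := by linarith
  refine ⟨(orient X B Y / (orient X B Y + orient A X Y)) • A +
    (orient A X Y / (orient X B Y + orient A X Y)) • B,
    ⟨_, _, by positivity, by positivity, by field_simp, rfl⟩,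
    orient A B Y / (orient X B Y + orient A X Y), orient A X B / (orient X B Y + orient A X Y),
    by positivity, by positivity, by rw [← add_div, hsum, div_self hS.ne'], ?_⟩
  apply Complex.ext
  · simp only [Complex.add_re, Complex.real_smul, Complex.mul_re, Complex.ofReal_re,
      Complex.ofReal_im, zero_mul, sub_zero]
    field_simp
    simp only [orient]
    ring
  · simp only [Complex.add_im, Complex.real_smul, Complex.mul_im, Complex.ofReal_re,
      Complex.ofReal_im, zero_mul, add_zero]
    field_simp
    simp only [orient]
    ring

/-- Chords that are not interlaced are disjoint. -/
theorem disjoint_of_not_interlaced {n : ℕ} {a b x y : Fin n} (hab : a < b) (hxy : x < y)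
    (hne : ¬ (a = x ∧ b = y)) (h1 : ¬ (a < x ∧ x < b ∧ b < y)) (h2 : ¬ (x < a ∧ a < y ∧ y < b)) :
    Disjoint (openSegment ℝ (polygonVertex n a) (polygonVertex n b))
      (openSegment ℝ (polygonVertex n x) (polygonVertex n y)) := by
  rw [Set.disjoint_left]
  rintro z hz ⟨s, t, hs, ht, hst, rfl⟩
  have h0 := orient_of_mem_openSegment hz
  rw [orient_combo _ _ _ _ _ _ hst] at h0
  -- This affine function vanishes on the line through `a` and `b`, is negative at the vertices
  -- strictly between them and positive at the vertices outside. Two vertices `x`, `y` that do not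
  -- separate `a` from `b` cannot have values of opposite sign, so a common point forces both values
  -- to vanish.
  set ℓ : Fin n → ℝ := fun v => orient (polygonVertex n a) (polygonVertex n b) (polygonVertex n v)
    with hℓ
  have ha : ℓ a = 0 := by simp only [hℓ, orient]; ring
  have hb : ℓ b = 0 := by simp only [hℓ, orient]; ring
  have hin : ∀ v, a < v → v < b → ℓ v < 0 := by
    intro v h1 h2
    have := orient_polygonVertex_pos h1 h2
    rw [orient_swap] at this
    simp only [hℓ]
    linarith
  have hout : ∀ v, v < a ∨ b < v → 0 < ℓ v := by
    rintro v (h | h)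
    · have := orient_polygonVertex_pos h hab
      rwa [← orient_rotate] at this
    · exact orient_polygonVertex_pos hab h
  change s * ℓ x + t * ℓ y = 0 at h0
  have trich : ∀ v, (a < v ∧ v < b ∧ ℓ v < 0) ∨ ((v < a ∨ b < v) ∧ 0 < ℓ v) ∨
      ((v = a ∨ v = b) ∧ ℓ v = 0) := by
    intro v
    rcases lt_trichotomy v a with h | rfl | h
    · exact Or.inr (Or.inl ⟨Or.inl h, hout v (Or.inl h)⟩)
    · exact Or.inr (Or.inr ⟨Or.inl rfl, ha⟩)
    rcases lt_trichotomy v b with h' | rfl | h'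
    · exact Or.inl ⟨h, h', hin v h h'⟩
    · exact Or.inr (Or.inr ⟨Or.inr rfl, hb⟩)
    · exact Or.inr (Or.inl ⟨Or.inr h', hout v (Or.inr h')⟩)
  rcases trich x with ⟨p1, p2, p3⟩ | ⟨p1, p3⟩ | ⟨p1, p3⟩ <;>
  rcases trich y with ⟨q1, q2, q3⟩ | ⟨q1, q3⟩ | ⟨q1, q3⟩
  · nlinarith [mul_neg_of_pos_of_neg hs p3, mul_neg_of_pos_of_neg ht q3]
  · omega
  · rw [q3] at h0; nlinarith [mul_neg_of_pos_of_neg hs p3]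
  · omega
  · nlinarith [mul_pos hs p3, mul_pos ht q3]
  · rw [q3] at h0; nlinarith [mul_pos hs p3]
  · rw [p3] at h0; nlinarith [mul_neg_of_pos_of_neg ht q3]
  · rw [p3] at h0; nlinarith [mul_pos ht q3]
  · omega

theorem noInterlacing_iff {n : ℕ} (G : SimpleGraph (Fin n)) :
    NoInterlacing G ↔ ∀ a b x y : Fin n, G.Adj a b → G.Adj x y → s(a, b) ≠ s(x, y) →
      Disjoint (openSegment ℝ (polygonVertex n a) (polygonVertex n b))
        (openSegment ℝ (polygonVertex n x) (polygonVertex n y)) := by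
  constructor
  · intro h
    have key : ∀ a b x y : Fin n, a < b → x < y → G.Adj a b → G.Adj x y → s(a, b) ≠ s(x, y) →
      Disjoint (openSegment ℝ (polygonVertex n a) (polygonVertex n b))
        (openSegment ℝ (polygonVertex n x) (polygonVertex n y)) := by
      intro a b x y hab hxy g1 g2 hne
      refine disjoint_of_not_interlaced hab hxy ?_ (fun h' => h g1 g2 h'.1 h'.2.1 h'.2.2)
        (fun h' => h g2 g1 h'.1 h'.2.1 h'.2.2)
      rintro ⟨rfl, rfl⟩
      exact hne rfl
    intro a b x y g1 g2 hne
    rcases lt_or_gt_of_ne g1.ne with hab | hab <;> rcases lt_or_gt_of_ne g2.ne with hxy | hxy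
    · exact key a b x y hab hxy g1 g2 hne
    · rw [openSegment_symm ℝ (polygonVertex n x)]
      exact key a b y x hab hxy g1 g2.symm (by rwa [Sym2.eq_swap (a := y)])
    · rw [openSegment_symm ℝ (polygonVertex n a)]
      exact key b a x y hab hxy g1.symm g2 (by rwa [Sym2.eq_swap (a := b)])
    · rw [openSegment_symm ℝ (polygonVertex n a), openSegment_symm ℝ (polygonVertex n x)]
      exact key b a y x hab hxy g1.symm g2.symm
        (by rwa [Sym2.eq_swap (a := b), Sym2.eq_swap (a := y)])
  · intro h a b x y g1 g2 h1 h2 h3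
    refine not_disjoint_of_interlaced h1 h2 h3 (h a b x y g1 g2 ?_)
    intro he
    rw [Sym2.eq_iff] at he
    rcases he with ⟨rfl, rfl⟩ | ⟨rfl, rfl⟩
    · exact lt_irrefl _ h1
    · exact absurd (h1.trans h2) (not_lt.2 h3.le)

/-! ### Outdegrees and degrees -/

/-- The parent is the last vertex before `v` on the path from the root; another one would give a
second path. -/
theorem exists_unique_parent {V : Type*} {G : SimpleGraph V} (hG : G.IsTree) {r v : V}
    (hv : v ≠ r) : ∃! w, G.Adj v w ∧ G.dist r w + 1 = G.dist r v := by
  obtain ⟨p, hp⟩ := hG.connected.exists_walk_length_eq_dist r v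
  have hnil : ¬ p.Nil := fun h => hv h.eq.symm
  have hpath := p.isPath_of_length_eq_dist hp
  refine ⟨p.penultimate, ⟨(p.adj_penultimate hnil).symm, ?_⟩, ?_⟩
  · have h1 := dist_le p.dropLast
    have h2 := p.length_dropLast_add_one hnil
    have h3 := hG.dist_eq_dist_add_one_of_adj r (p.adj_penultimate hnil)
    omega
  · rintro w ⟨hw, hd⟩
    obtain ⟨q, hq⟩ := hG.connected.exists_walk_length_eq_dist r w
    have hq' : (q.concat hw.symm).length = G.dist r v := by rw [Walk.length_concat, hq, hd]
    have hpath' := (q.concat hw.symm).isPath_of_length_eq_dist hq'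
    have := (hG.isAcyclic.subsingleton_path r v).elim ⟨p, hpath⟩ ⟨_, hpath'⟩
    have := congrArg Subtype.val this
    simp only at this
    rw [this, Walk.penultimate_concat]

theorem outdegree_root {V : Type*} {G : SimpleGraph V} (r : V) : outdegree G r r = deg G r := by
  rw [outdegree, deg]
  congr 1
  ext w
  simp only [Set.mem_ofPred_eq, mem_neighborSet, dist_self, zero_add, dist_eq_one_iff_adj, and_self]

theorem outdegree_add_one {V : Type*} [Finite V] {G : SimpleGraph V} (hG : G.IsTree) {r v : V}
    (hv : v ≠ r) : outdegree G r v + 1 = deg G v := by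
  obtain ⟨w, ⟨hw, hd⟩, huniq⟩ := exists_unique_parent hG hv
  have e : G.neighborSet v = insert w {w | G.Adj v w ∧ G.dist r w = G.dist r v + 1} := by
    ext u
    simp only [mem_neighborSet, Set.mem_insert_iff, Set.mem_ofPred_eq]
    constructor
    · intro hu
      rcases hG.dist_eq_dist_add_one_of_adj r hu with h | h
      · exact Or.inl (huniq u ⟨hu, h.symm⟩)
      · exact Or.inr ⟨hu, h⟩
    · rintro (rfl | h)
      · exact hw
      · exact h.1
  rw [deg, e, Set.ncard_insert_of_notMem, outdegree]
  simp only [Set.mem_ofPred_eq, not_and]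
  omega

/-- Only the root has no parent, whence `k` at the root and `k + 1` elsewhere. -/
theorem maxOutdegree_le_iff {V : Type*} [Fintype V] {G : SimpleGraph V} (hG : G.IsTree) {r : V}
    {k : ℕ} : maxOutdegree G r ≤ k ↔ deg G r ≤ k ∧ ∀ v, v ≠ r → deg G v ≤ k + 1 := by
  rw [maxOutdegree, Finset.sup_le_iff]
  constructor
  · intro h
    refine ⟨outdegree_root (G := G) r ▸ h r (Finset.mem_univ r), fun v hv => ?_⟩
    rw [← outdegree_add_one hG hv]
    exact Nat.succ_le_succ (h v (Finset.mem_univ v))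
  · intro h v _
    by_cases hv : v = r
    · rw [hv, outdegree_root]; exact h.1
    · have := h.2 v hv
      rw [← outdegree_add_one hG hv] at this
      omega

/-! ### Trees of the polygon and trees on intervals -/

/-- The vertices of the `n`-gon as integers. -/
def finToInt (n : ℕ) : Fin n ↪ ℤ := ⟨fun i => ((i : ℕ) : ℤ), fun i j h => Fin.ext (by simpa using h)⟩

theorem finToInt_apply {n : ℕ} (i : Fin n) : finToInt n i = ((i : ℕ) : ℤ) := rfl

theorem exists_finToInt_eq {m : ℕ} {x : ℤ} (h0 : 0 ≤ x) (hm : x ≤ m) :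
    ∃ i : Fin (m + 1), finToInt (m + 1) i = x :=
  ⟨⟨x.toNat, by omega⟩, by simp [finToInt_apply, h0]⟩

theorem deg_map_finToInt {n : ℕ} (G : SimpleGraph (Fin n)) (i : Fin n) :
    deg (G.map (finToInt n)) (finToInt n i) = deg G i := by
  have : (G.map (finToInt n)).neighborSet (finToInt n i) = finToInt n '' G.neighborSet i := by
    ext y
    simp only [mem_neighborSet, map_adj, Set.mem_image]
    constructor
    · rintro ⟨u, v, huv, hu, rfl⟩
      obtain rfl := (finToInt n).injective hu
      exact ⟨v, huv, rfl⟩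
    · rintro ⟨v, hv, rfl⟩
      exact ⟨i, v, hv, rfl, rfl⟩
  rw [deg, this, Set.ncard_image_of_injective _ (finToInt n).injective, deg]

theorem livesOn_map_finToInt {m : ℕ} (G : SimpleGraph (Fin (m + 1))) :
    LivesOn 0 m (G.map (finToInt (m + 1))) := by
  intro x y hxy
  obtain ⟨u, v, -, rfl, rfl⟩ := (map_adj _ _ _ _).1 hxy
  have := u.2
  rw [finToInt_apply]
  omega

/-- Describing trees by connectedness and the number of edges avoids transporting acyclicity to `ℤ`,
where the other integers are isolated vertices. -/
theorem isIntervalTree_map_iff {m : ℕ} (G : SimpleGraph (Fin (m + 1))) :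
    IsIntervalTree 0 m (G.map (finToInt (m + 1))) ↔ IsNonCrossingTree G := by
  set f := finToInt (m + 1) with hf
  have hcard : (G.map f).edgeSet.ncard = G.edgeSet.ncard := by
    rw [edgeSet_map, Set.ncard_image_of_injective _ (Function.Embedding.injective _)]
  have hconn : (∀ ⦃x y : ℤ⦄, 0 ≤ x → x ≤ m → 0 ≤ y → y ≤ m → (G.map f).Reachable x y) ↔
      G.Connected := by
    constructor
    · intro h
      refine ⟨fun a b => ?_⟩
      have ha := a.2
      have hb := b.2
      have hab := h (x := f a) (y := f b) (by rw [hf, finToInt_apply]; omega)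
        (by rw [hf, finToInt_apply]; omega) (by rw [hf, finToInt_apply]; omega)
        (by rw [hf, finToInt_apply]; omega)
      refine reachable_induction (P := fun z => ∀ b, f b = z → G.Reachable a b) ?_ hab ?_ b rfl
      · intro x y hxy hx b hb
        obtain ⟨u, v, huv, rfl, rfl⟩ := (map_adj _ _ _ _).1 hxy
        obtain rfl := f.injective hb
        exact (hx u rfl).trans huv.reachable
      · intro b hb
        obtain rfl := f.injective hb
        exact Reachable.refl _
    · intro h x y hx hx' hy hy'
      obtain ⟨i, rfl⟩ := exists_finToInt_eq hx hx'
      obtain ⟨j, rfl⟩ := exists_finToInt_eq hy hy'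
      exact (h i j).map (Embedding.map f G).toHom
  have hnc : NoInterlacing (G.map f) ↔ NoInterlacing G := by
    constructor
    · intro h a b x y g1 g2 h1 h2 h3
      refine h (a := f a) (b := f b) (x := f x) (y := f y) ((map_adj_apply).2 g1)
        ((map_adj_apply).2 g2) ?_ ?_ ?_ <;> simp only [hf, finToInt_apply] <;> omega
    · intro h a b x y g1 g2 h1 h2 h3
      obtain ⟨a, b, e1, rfl, rfl⟩ := (map_adj _ _ _ _).1 g1
      obtain ⟨x, y, e2, rfl, rfl⟩ := (map_adj _ _ _ _).1 g2
      simp only [hf, finToInt_apply] at h1 h2 h3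
      exact h e1 e2 (by omega) (by omega) (by omega)
  have htree : G.IsTree ↔ G.Connected ∧ G.edgeSet.ncard = m := by
    rw [isTree_iff_connected_and_card, Nat.card_coe_set_eq, Nat.card_eq_fintype_card,
      Fintype.card_fin]
    simp
  rw [IsNonCrossingTree, ← noInterlacing_iff, htree, ← hconn, ← hnc, ← hcard]
  constructor
  · intro h
    refine ⟨⟨h.reach, ?_⟩, h.noncross⟩
    have := h.card
    omega
  · rintro ⟨⟨h1, h2⟩, h3⟩
    exact ⟨livesOn_map_finToInt G, h1, by rw [h2]; omega, h3⟩

theorem ncard_maxOutdegree_le (k m : ℕ) :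
    (nonCrossingTrees (m + 1) ∩ {G | maxOutdegree G 0 ≤ k}).ncard = boundedCount k m := by
  classical
  set f := finToInt (m + 1) with hf
  have hzero : f 0 = 0 := by simp [hf, finToInt_apply]
  -- Sorting by the root degree `r` gives disjoint sets, and their sizes add up to `boundedCount`.
  have himage : (fun G : SimpleGraph (Fin (m + 1)) => G.map f) ''
      (nonCrossingTrees (m + 1) ∩ {G | maxOutdegree G 0 ≤ k}) =
      ⋃ r ∈ Finset.range (k + 1), boundedTrees k 0 m 0 r := by
    ext H
    simp only [Set.mem_image, Set.mem_iUnion, Finset.mem_range, boundedTrees, Set.mem_ofPred_eq,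
      exists_prop, Set.mem_inter_iff, nonCrossingTrees]
    constructor
    · rintro ⟨G, ⟨hG, hk⟩, rfl⟩
      rw [maxOutdegree_le_iff hG.1] at hk
      refine ⟨deg G 0, by omega, (isIntervalTree_map_iff G).2 hG, ?_, ?_⟩
      · rw [← deg_map_finToInt G 0, ← hf, hzero]
      · intro x hx
        by_cases hx' : 0 ≤ x ∧ x ≤ m
        · obtain ⟨i, rfl⟩ := exists_finToInt_eq hx'.1 hx'.2
          rw [hf, deg_map_finToInt]
          refine hk.2 i ?_
          rintro rfl
          exact hx hzero
        · rw [(livesOn_map_finToInt G).deg_eq_zero (by omega)]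
          omega
    · rintro ⟨r, hr, hH, h0, hd⟩
      have e : (H.comap f).map f = H := by
        refine le_antisymm (map_comap_le f H) ?_
        intro x y hxy
        obtain ⟨i, rfl⟩ := exists_finToInt_eq (hH.mem hxy).1 (hH.mem hxy).2
        obtain ⟨j, rfl⟩ := exists_finToInt_eq (hH.mem hxy.symm).1 (hH.mem hxy.symm).2
        exact (map_adj _ _ _ _).2 ⟨i, j, hxy, rfl, rfl⟩
      have hT : IsNonCrossingTree (H.comap f) := by
        rw [← isIntervalTree_map_iff, ← hf, e]
        exact hH
      refine ⟨H.comap f, ⟨hT, ?_⟩, e⟩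
      rw [maxOutdegree_le_iff hT.1]
      refine ⟨?_, fun v hv => ?_⟩
      · rw [← deg_map_finToInt, ← hf, e, hzero, h0]
        omega
      · rw [← deg_map_finToInt, ← hf, e]
        refine hd _ fun h => hv ?_
        rw [← hzero] at h
        exact f.injective h
  rw [← Set.ncard_image_of_injective _ (map_injective f), himage, boundedCount]
  have := (Finset.finite_toSet (Finset.range (k + 1))).ncard_biUnion
    (s := fun r => boundedTrees k 0 m 0 r) (fun r _ => finite_boundedTrees k 0 m 0 r) ?_
  · rw [finsum_mem_coe_finset] at this
    simpa only [Finset.mem_coe, treeCount] using this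
  · intro r _ r' _ hne
    rw [Function.onFun, Set.disjoint_left]
    intro H h h'
    exact hne (h.2.1.symm.trans h'.2.1)

end NonCrossing

namespace NonCrossing

open MeasureTheory

/-! ### The uniform distribution -/

instance measurableSingletonClass_simpleGraph {V : Type*} [Countable V] :
    MeasurableSingletonClass (SimpleGraph V) where
  measurableSet_singleton G := by
    have : ({G} : Set (SimpleGraph V)) = ⋂ (u : V) (v : V), {H | H.Adj u v ↔ G.Adj u v} := by
      ext H
      simp only [Set.mem_singleton_iff, Set.mem_iInter, Set.mem_ofPred_eq]
      constructor
      · rintro rfl u v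
        rfl
      · intro h
        ext u v
        exact h u v
    rw [this]
    refine MeasurableSet.iInter fun u => MeasurableSet.iInter fun v => ?_
    have hm : Measurable fun H : SimpleGraph V => H.Adj u v :=
      SimpleGraph.measurable_iff_adj.1 measurable_id u v
    by_cases h : G.Adj u v
    · simpa [h] using hm.setOf
    · have e : {H : SimpleGraph V | H.Adj u v ↔ G.Adj u v} = {H | H.Adj u v}ᶜ := by
        ext H
        simp [h]
      rw [e]
      exact hm.setOf.compl

theorem uniformOn_real_apply {Ω : Type*} [Finite Ω] [MeasurableSpace Ω]
    [MeasurableSingletonClass Ω] (s t : Set Ω) :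
    (uniformOn s).real t = (s ∩ t).ncard / s.ncard := by
  classical
  have h := uniformOn_apply_finset (s := s.toFinite.toFinset) (t := t.toFinite.toFinset)
  simp only [Set.Finite.coe_toFinset] at h
  rw [measureReal_def, h, ENNReal.toReal_div, ENNReal.toReal_natCast, ENNReal.toReal_natCast,
    Set.ncard_eq_toFinset_card s, Set.ncard_eq_toFinset_card (s ∩ t)]
  congr 3
  ext
  simp

theorem maxOutdegree_le {m : ℕ} {G : SimpleGraph (Fin (m + 1))} (r : Fin (m + 1)) :
    maxOutdegree G r ≤ m := by
  refine Finset.sup_le fun v _ => ?_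
  have h : {w | G.Adj v w ∧ G.dist r w = G.dist r v + 1} ⊂ Set.univ :=
    (Set.ssubset_univ_iff).2 fun h => by
      have : v ∈ {w | G.Adj v w ∧ G.dist r w = G.dist r v + 1} := h ▸ Set.mem_univ v
      exact G.irrefl this.1
  have := Set.ncard_lt_ncard h (Set.toFinite _)
  rw [Set.ncard_univ, Nat.card_eq_fintype_card, Fintype.card_fin] at this
  exact Nat.lt_succ_iff.1 this

theorem ncard_nonCrossingTrees (m : ℕ) : (nonCrossingTrees (m + 1)).ncard = boundedCount m m := by
  rw [← ncard_maxOutdegree_le]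
  congr 1
  ext G
  simp [maxOutdegree_le]

theorem boundedCount_self_pos (m : ℕ) : 0 < boundedCount m m := by
  rw [← ncard_nonCrossingTrees]
  exact (Set.ncard_pos (Set.toFinite _)).2 (nonCrossingTrees_nonempty (m + 1))

theorem uniformOn_maxOutdegree_le (k m : ℕ) :
    (uniformOn (nonCrossingTrees (m + 1))).real {G | maxOutdegree G 0 ≤ k} =
      boundedCount k m / boundedCount m m := by
  rw [uniformOn_real_apply, ncard_maxOutdegree_le, ncard_nonCrossingTrees]

instance isProbabilityMeasure_nonCrossingTrees (n : ℕ) [NeZero n] :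
    IsProbabilityMeasure (uniformOn (nonCrossingTrees n)) :=
  isProbabilityMeasure_uniformOn (Set.toFinite _) (nonCrossingTrees_nonempty n)

theorem uniformOn_lt_maxOutdegree (k : ℕ) {m : ℕ} (hm : 0 < m) :
    (uniformOn (nonCrossingTrees (m + 1))).real {G | k < maxOutdegree G 0} ≤
      (m + 3) * ((2 * k + 5) / (4 * 3 ^ k)) := by
  have e : {G : SimpleGraph (Fin (m + 1)) | k < maxOutdegree G 0} =
      {G | maxOutdegree G 0 ≤ k}ᶜ := by
    ext G
    simp
  have hpos : (0 : ℝ) < boundedCount m m := by exact_mod_cast boundedCount_self_pos m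
  rw [e, probReal_compl_eq_one_sub (Set.toFinite _).measurableSet, uniformOn_maxOutdegree_le,
    ← div_self hpos.ne', ← sub_div, div_le_iff₀ hpos]
  exact boundedCount_upper k hm

theorem uniformOn_maxOutdegree_le_exp (k : ℕ) {m : ℕ} (hm : 0 < m) :
    (uniformOn (nonCrossingTrees (m + 1))).real {G | maxOutdegree G 0 ≤ k} ≤
      8 * Real.exp (-((m / 2 : ℕ) * ((2 * k + 5) / (9 * 3 ^ k)))) := by
  have hpos : (0 : ℝ) < boundedCount m m := by exact_mod_cast boundedCount_self_pos m
  rw [uniformOn_maxOutdegree_le, div_le_iff₀ hpos]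
  refine (boundedCount_lower k hm).trans ?_
  refine mul_le_mul_of_nonneg_right ?_ hpos.le
  refine mul_le_mul_of_nonneg_left ?_ (by norm_num)
  rw [← mul_neg, Real.exp_nat_mul]
  refine pow_le_pow_left₀ ?_ (Real.one_sub_le_exp_neg _) _
  -- Raising `1 - x ≤ exp (-x)` to a power requires `x ≤ 1`, which follows from Bernoulli's
  -- inequality.
  have h1 : (1 : ℝ) + k * 2 ≤ 3 ^ k := by
    have := one_add_mul_le_pow (a := (2 : ℝ)) (by norm_num) k
    norm_num at this
    exact this
  rw [sub_nonneg, div_le_one (by positivity)]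
  linarith [Nat.cast_nonneg (α := ℝ) k]

/-! ### Asymptotics -/

theorem logb_three_le_self {L : ℝ} (hL : 1 ≤ L) : Real.logb 3 L ≤ L := by
  have h3 : 1 ≤ Real.log 3 := by
    rw [Real.le_log_iff_exp_le (by norm_num)]
    linarith [Real.exp_one_lt_d9]
  have h1 := Real.log_nonneg hL
  have h2 := Real.log_le_sub_one_of_pos (show 0 < L by linarith)
  rw [Real.logb]
  refine (div_le_self h1 h3).trans ?_
  linarith

/-- At this threshold the tail `n k / 3 ^ k` has order `L ^ (1 - e)`, with `L = log_3 n`, when `k`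
is comparable to `L`. The values `e = 1 + c` and `e = 1 - c` thus produce `L ^ (-c)` and `L ^ c`. -/
theorem three_rpow_threshold {n : ℕ} (hn : 0 < n) (hL : 0 < Real.logb 3 n) (e : ℝ) :
    (3 : ℝ) ^ (Real.logb 3 n + e * Real.logb 3 (Real.logb 3 n)) = n * (Real.logb 3 n) ^ e := by
  rw [Real.rpow_add (by norm_num), Real.rpow_logb (by norm_num) (by norm_num) (by exact_mod_cast hn),
    mul_comm e, Real.rpow_mul (by norm_num), Real.rpow_logb (by norm_num) (by norm_num) hL]

theorem one_le_logb_three {n : ℕ} (hn : 3 ≤ n) : 1 ≤ Real.logb 3 n := by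
  rw [Real.le_logb_iff_rpow_le (by norm_num) (by positivity), Real.rpow_one]
  exact_mod_cast hn

theorem upper_tail_of_three_le {c : ℝ} (hc : 0 < c) {n : ℕ} [NeZero n] (hn : 3 ≤ n) :
    (uniformOn (nonCrossingTrees n)).real
        {T | Real.logb 3 n + (1 + c) * Real.logb 3 (Real.logb 3 n) ≤ (maxOutdegree T 0 : ℝ)} ≤
      (3 / 2 * (9 + 2 * c)) / (Real.logb 3 n) ^ c := by
  have hL := one_le_logb_three hn
  have hthree := three_rpow_threshold (n := n) (by omega) (by linarith) (1 + c)
  set L := Real.logb 3 n with hLdef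
  have hLL := logb_three_le_self hL
  have hLL0 : 0 ≤ Real.logb 3 L := Real.logb_nonneg (by norm_num) hL
  set x := L + (1 + c) * Real.logb 3 L with hx
  have hx1 : 1 ≤ x := by
    have : 0 ≤ (1 + c) * Real.logb 3 L := by positivity
    linarith
  obtain ⟨m, rfl⟩ : ∃ m, n = m + 1 := ⟨n - 1, by omega⟩
  -- The largest integer below `x`: an outdegree of at least `x` exceeds `k`, while `3 ^ (k + 1)` is
  -- still at least `3 ^ x`.
  obtain ⟨k, hk⟩ : ∃ k, ⌈x⌉₊ = k + 1 :=
    ⟨⌈x⌉₊ - 1, by have := Nat.ceil_pos.2 (show 0 < x by linarith); omega⟩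
  have hkx : (k : ℝ) < x := by
    rw [← Nat.lt_ceil]; omega
  have hxk : x ≤ k + 1 := by
    have := Nat.le_ceil x
    rw [hk] at this
    exact_mod_cast this
  have hsub : {T : SimpleGraph (Fin (m + 1)) | x ≤ (maxOutdegree T 0 : ℝ)} ⊆
      {T | k < maxOutdegree T 0} := by
    intro T hT
    have h1 : (k : ℝ) < maxOutdegree T 0 := hkx.trans_le hT
    exact_mod_cast h1
  refine (measureReal_mono hsub).trans ((uniformOn_lt_maxOutdegree k (by omega)).trans ?_)
  have hpow : ((m + 1 : ℕ) : ℝ) * L ^ (1 + c) ≤ 3 * 3 ^ k := by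
    rw [← hthree, ← pow_succ', ← Real.rpow_natCast]
    refine Real.rpow_le_rpow_of_exponent_le (by norm_num) ?_
    push_cast
    exact hxk
  have hL0 : 0 < L := by linarith
  have hLc : 0 < L ^ c := Real.rpow_pos_of_pos hL0 c
  rw [Real.rpow_add hL0, Real.rpow_one] at hpow
  push_cast at hpow
  -- From `k < x ≤ (2 + c) L` and `5 ≤ 5 L`.
  have hk5 : 2 * (k : ℝ) + 5 ≤ (9 + 2 * c) * L := by
    have : (1 + c) * Real.logb 3 L ≤ (1 + c) * L := by gcongr
    nlinarith
  have hm3 : (m : ℝ) + 3 ≤ 2 * (m + 1) := by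
    have : (1 : ℝ) ≤ m := by exact_mod_cast (by omega : 1 ≤ m)
    linarith
  have hp : (0 : ℝ) < 3 ^ k := by positivity
  rw [le_div_iff₀ hLc, ← mul_div_assoc, div_mul_eq_mul_div, div_le_iff₀ (by positivity)]
  have hm0 : (0 : ℝ) ≤ m := Nat.cast_nonneg m
  have hk0 : (0 : ℝ) ≤ 2 * k + 5 := by positivity
  calc ((m : ℝ) + 3) * (2 * k + 5) * L ^ c
      ≤ (2 * (m + 1)) * ((9 + 2 * c) * L) * L ^ c := by gcongr
    _ = 2 * (9 + 2 * c) * ((m + 1) * (L * L ^ c)) := by ring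
    _ ≤ 2 * (9 + 2 * c) * (3 * 3 ^ k) := by gcongr
    _ = _ := by ring

/-- For `c > 1` the threshold can be much smaller than `L` at moderate `L`. Since `log L / L` tends
to 0, it is at least `L / 2` from some `M` on; below `M` the constant 3 suffices, which dictates `δ
= 3 / M`. -/
theorem exists_linear_bound (c : ℝ) : ∃ δ : ℝ, 0 < δ ∧ ∀ L : ℝ, 1 ≤ L →
    0 ≤ L + (1 - c) * Real.logb 3 L → δ * L ≤ 2 * (L + (1 - c) * Real.logb 3 L) + 3 := by
  have hlim : Filter.Tendsto (fun L : ℝ => Real.logb 3 L / L) Filter.atTop (nhds 0) := by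
    have h1 := (Real.isLittleO_log_id_atTop.tendsto_div_nhds_zero).div_const (Real.log 3)
    rw [zero_div] at h1
    refine h1.congr fun L => ?_
    rw [Real.logb, id, div_right_comm]
  have hlim2 : Filter.Tendsto (fun L : ℝ => (1 - c) * (Real.logb 3 L / L)) Filter.atTop (nhds 0) := by
    simpa using hlim.const_mul (1 - c)
  have hev := hlim2.eventually (lt_mem_nhds (show (-1 / 2 : ℝ) < 0 by norm_num))
  obtain ⟨L₀, hL₀⟩ := Filter.eventually_atTop.1 hev
  set M := max L₀ 3 with hM
  have hM3 : 3 ≤ M := le_max_right _ _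
  refine ⟨3 / M, by positivity, fun L hL h0 => ?_⟩
  rcases le_or_gt M L with h | h
  · have h1 := hL₀ L ((le_max_left _ _).trans h)
    have h2 : (-1 / 2) * L < (1 - c) * Real.logb 3 L := by
      have := mul_lt_mul_of_pos_right h1 (show 0 < L by linarith)
      rwa [mul_assoc, div_mul_cancel₀ _ (by linarith : L ≠ 0)] at this
    have h3 : 3 / M * L ≤ L := by
      have : 3 / M ≤ 1 := (div_le_one (by linarith)).2 hM3
      nlinarith
    linarith
  · have : 3 / M * L ≤ 3 := by
      rw [div_mul_eq_mul_div, div_le_iff₀ (by linarith)]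
      linarith
    linarith

theorem lower_tail_of_three_le {c δ : ℝ} (hδ : 0 < δ) (hlin : ∀ L : ℝ, 1 ≤ L →
    0 ≤ L + (1 - c) * Real.logb 3 L → δ * L ≤ 2 * (L + (1 - c) * Real.logb 3 L) + 3)
    {n : ℕ} [NeZero n] (hn : 3 ≤ n) :
    (uniformOn (nonCrossingTrees n)).real
        {T | (maxOutdegree T 0 : ℝ) ≤ Real.logb 3 n + (1 - c) * Real.logb 3 (Real.logb 3 n)} ≤
      8 * Real.exp (-(δ / 54) * (Real.logb 3 n) ^ c) := by
  have hL := one_le_logb_three hn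
  have hthree := three_rpow_threshold (n := n) (by omega) (by linarith) (1 - c)
  set L := Real.logb 3 n with hLdef
  have hlin := hlin L hL
  set x := L + (1 - c) * Real.logb 3 L with hx
  obtain ⟨m, rfl⟩ : ∃ m, n = m + 1 := ⟨n - 1, by omega⟩
  -- For large `c` the threshold may be negative; the event is then empty.
  rcases lt_or_ge x 0 with hneg | hx0
  · have : {T : SimpleGraph (Fin (m + 1)) | (maxOutdegree T 0 : ℝ) ≤ x} = ∅ := by
      refine Set.eq_empty_of_forall_notMem fun T hT => ?_
      have h1 : (maxOutdegree T 0 : ℝ) ≤ x := hT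
      linarith [Nat.cast_nonneg (α := ℝ) (maxOutdegree T 0)]
    rw [this, measureReal_empty]
    positivity
  have hlin := hlin hx0
  set k := ⌊x⌋₊ with hk
  have hkx : (k : ℝ) ≤ x := Nat.floor_le hx0
  have hxk : x ≤ k + 1 := (Nat.lt_floor_add_one x).le
  have hsub : {T : SimpleGraph (Fin (m + 1)) | (maxOutdegree T 0 : ℝ) ≤ x} ⊆
      {T | maxOutdegree T 0 ≤ k} := fun T hT => Nat.le_floor hT
  refine (measureReal_mono hsub).trans ((uniformOn_maxOutdegree_le_exp k (by omega)).trans ?_)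
  refine mul_le_mul_of_nonneg_left (Real.exp_le_exp.2 ?_) (by norm_num)
  rw [neg_mul, neg_le_neg_iff]
  have hL0 : 0 < L := by linarith
  have hLc : 0 < L ^ c := Real.rpow_pos_of_pos hL0 c
  have hpow : (3 : ℝ) ^ k * L ^ c ≤ ((m + 1 : ℕ) : ℝ) * L := by
    have h1 : (3 : ℝ) ^ k ≤ ((m + 1 : ℕ) : ℝ) * L ^ (1 - c) := by
      rw [← hthree, ← Real.rpow_natCast]
      exact Real.rpow_le_rpow_of_exponent_le (by norm_num) hkx
    calc (3 : ℝ) ^ k * L ^ c ≤ ((m + 1 : ℕ) : ℝ) * L ^ (1 - c) * L ^ c := by gcongr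
      _ = ((m + 1 : ℕ) : ℝ) * L := by
        rw [mul_assoc, ← Real.rpow_add hL0, sub_add_cancel, Real.rpow_one]
  push_cast at hpow
  -- The 6 absorbs the rounding in `m / 2`; with the 9 of the exponential bound it makes up the
  -- constant 54.
  have hm6 : ((m : ℝ) + 1) / 6 ≤ ((m / 2 : ℕ) : ℝ) := by
    rw [div_le_iff₀ (by norm_num)]
    have : m + 1 ≤ m / 2 * 6 := by omega
    exact_mod_cast this
  have hk5 : δ * L ≤ 2 * (k : ℝ) + 5 := by linarith
  have hp : (0 : ℝ) < 3 ^ k := by positivity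
  rw [← mul_div_assoc, le_div_iff₀ (by positivity)]
  have hm0 : (0 : ℝ) ≤ m := Nat.cast_nonneg m
  calc δ / 54 * L ^ c * (9 * 3 ^ k) = δ / 6 * (3 ^ k * L ^ c) := by ring
    _ ≤ δ / 6 * ((m + 1) * L) := by gcongr
    _ = (m + 1) / 6 * (δ * L) := by ring
    _ ≤ ((m / 2 : ℕ) : ℝ) * (2 * k + 5) := by gcongr

theorem logb_three_two_rpow_le_one {c : ℝ} (hc : 0 < c) :
    0 < (Real.logb 3 (2 : ℕ)) ^ c ∧ (Real.logb 3 (2 : ℕ)) ^ c ≤ 1 := by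
  have h0 : 0 < Real.logb 3 (2 : ℕ) := Real.logb_pos (by norm_num) (by norm_num)
  have h1 : Real.logb 3 (2 : ℕ) ≤ 1 := by
    rw [Real.logb_le_iff_le_rpow (by norm_num) (by norm_num)]
    norm_num
  exact ⟨Real.rpow_pos_of_pos h0 c, Real.rpow_le_one h0.le h1 hc.le⟩

end NonCrossing

theorem theorem4 (c : ℝ) (hc : 0 < c) :
    ∃ C₁ C₂ : ℝ, 0 < C₁ ∧ 0 < C₂ ∧ ∀ (n : ℕ) [NeZero n], 2 ≤ n →
      (uniformOn (NonCrossing.nonCrossingTrees n)).real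
          {T | Real.logb 3 n + (1 + c) * Real.logb 3 (Real.logb 3 n) ≤
            (NonCrossing.maxOutdegree T 0 : ℝ)} ≤
        C₁ / (Real.logb 3 n) ^ c ∧
      (uniformOn (NonCrossing.nonCrossingTrees n)).real
          {T | (NonCrossing.maxOutdegree T 0 : ℝ) ≤
            Real.logb 3 n + (1 - c) * Real.logb 3 (Real.logb 3 n)} ≤
        C₁ * Real.exp (-C₂ * (Real.logb 3 n) ^ c) := by
  obtain ⟨δ, hδ, hlin⟩ := NonCrossing.exists_linear_bound c
  have hE := Real.exp_pos (δ / 54)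
  -- The first two summands serve the two tails for `n ≥ 3`. The last one makes the second bound
  -- trivial for `n = 2`, where `(log_3 2) ^ c ≤ 1`.
  refine ⟨3 / 2 * (9 + 2 * c) + 8 + Real.exp (δ / 54), δ / 54, by positivity, by positivity, ?_⟩
  intro n _ hn
  rcases Nat.lt_or_ge n 3 with h2 | h3
  · obtain rfl : n = 2 := by omega
    obtain ⟨hpos, hle⟩ := NonCrossing.logb_three_two_rpow_le_one hc
    refine ⟨MeasureTheory.measureReal_le_one.trans ?_, MeasureTheory.measureReal_le_one.trans ?_⟩
    · rw [le_div_iff₀ hpos, one_mul]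
      refine hle.trans ?_
      linarith
    · calc (1 : ℝ) = Real.exp (δ / 54) * Real.exp (-(δ / 54)) := by
            rw [← Real.exp_add, add_neg_cancel, Real.exp_zero]
        _ ≤ _ := by
          refine mul_le_mul (by linarith) (Real.exp_le_exp.2 ?_) (Real.exp_pos _).le (by positivity)
          rw [neg_mul, neg_le_neg_iff]
          exact mul_le_of_le_one_right (by positivity) hle
  · have hpos : 0 < (Real.logb 3 n) ^ c :=
      Real.rpow_pos_of_pos (by linarith [NonCrossing.one_le_logb_three h3]) c
    constructor
    · refine (NonCrossing.upper_tail_of_three_le hc h3).trans ?_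
      gcongr
      linarith
    · refine (NonCrossing.lower_tail_of_three_le hδ hlin h3).trans ?_
      gcongr
      linarith [mul_pos (show (0 : ℝ) < 3 / 2 by norm_num) (show 0 < 9 + 2 * c by linarith)]
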